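/- Let $p>q>0$ and, for $\delta\ge 0$, put $$\Sigma(\delta)=p^{2+\delta}+q^{2+\delta}-1-\frac{2+\delta}{2}\,(p^2+q^2-1).$$ Consider the energy-rescaled one-dimensional Boltzmann equation $$\partial_t g-\tfrac12(p^2+q^2-1)\,\partial_v(vg)=\int_{\mathbb R}\Big(\tfrac1J\,g(v_*)g(w_*)-g(v)g(w)\Big)dw,\qquad J=p^2-q^2,$$ where $(v_*,w_*)$ are the velocities that the collision $(v,w)\mapsto(pv+qw,\;qv+pw)$ sends to $(v,w)$. A weak solution with initial datum a Borel probability measure $f_0$ on $\mathbb R$ is a weakly continuous curve $[0,\infty)\ni t\mapsto g(t)$ of Borel probability measures on $\mathbb R$ with $g(0)=f_0$ such that, for every $\varphi\in C_c^\infty(\mathbb R)$ and every $t>0$, $$\frac{d}{dt}\int\varphi\,dg(t)+\tfrac12(p^2+q^2-1)\int v\,\varphi'(v)\,g(t)(dv)=\iint\big(\varphi(pv+qw)-\varphi(v)\big)\,g(t)(dv)\,g(t)(dw).$$ A stationary solution is a probability measure for which this identity holds with the time derivative replaced by $0$. A probability measure $\mu$ is called normalized if $\int v^2\,d\mu=1$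 and $\int v\,d\mu=0$. For $s>0$ and $\hat\mu(\xi)=\int e^{-i\xi v}\mu(dv)$ let $$d_s(\mu,\nu)=\sup_{\xi\ne0}\frac{|\hat\mu(\xi)-\hat\nu(\xi)|}{|\xi|^s}\in[0,\infty].$$ **Theorem.** Let $\delta>0$ be such that $\Sigma(\delta)<0$. Then there is exactly one normalized stationary solution $g_\infty$, and $\int|v|^{2+\delta}\,dg_\infty<\infty$. Let $f_0$ be a normalized probability measure with $m_\delta=\int|v|^{2+\delta}\,df_0<\infty$. Then there is exactly one weak solution $g(t)$ with initial datum $f_0$, and: 1. There is a constant $c_\delta<\infty$, depending only on $p$, $q$, $\delta$ and $m_\delta$, such that $\int|v|^{2+\delta}\,dg(t)\le c_\delta$ for all $t\ge0$. If $0<\delta\le1$ one can take $$c_\delta=m_\delta+\frac{p^2q^\delta+q^2p^\delta}{|\Sigma(\delta)|}.$$ 2. For all $t\ge0$, $$d_{2+\delta}(g(t),g_\infty)\le d_{2+\delta}(f_0,g_\infty)\,e^{-|\Sigma(\delta)|t}$$ (an inequality in $[0,\infty]$). 3. For every $\eta$ with $0<\eta\le\min\{\delta,1\}$ one has $\Sigma(\eta)<0$,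 $d_{2+\eta}(f_0,g_\infty)<\infty$, and $d_{2+\eta}(g(t),g_\infty)\le d_{2+\eta}(f_0,g_\infty)\,e^{-|\Sigma(\eta)|t}$ for all $t\ge0$; in particular, if $\delta\le1$, the right-hand side in (2) is finite. -/

import Mathlib

open MeasureTheory Filter Topology
open scoped ContDiff ENNReal

noncomputable section

namespace MaxwellKinetic

/-- `Σ(δ) = p^{2+δ} + q^{2+δ} - 1 - ((2+δ)/2) (p² + q² - 1)`. -/
def keyFun (p q δ : ℝ) : ℝ :=
  p ^ (2 + δ) + q ^ (2 + δ) - 1 - (2 + δ) / 2 * (p ^ 2 + q ^ 2 - 1)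

/-- Zero mean and unit second moment. The integrability of `v²` (hence that of `v`, for a
finite measure) is stated explicitly. -/
structure IsNormalized (μ : ProbabilityMeasure ℝ) : Prop where
  integrable_sq : Integrable (fun v : ℝ => v ^ 2) (μ : Measure ℝ)
  mean : ∫ v, v ∂(μ : Measure ℝ) = 0
  energy : ∫ v, v ^ 2 ∂(μ : Measure ℝ) = 1

/-- The weak form of the rescaled collision dynamics, tested against `φ`:
`∬ (φ(pv + qw) - φ(v)) μ(dv) μ(dw) - ½ (p² + q² - 1) ∫ v φ'(v) μ(dv)`. -/
def weakOp (p q : ℝ) (μ : ProbabilityMeasure ℝ) (φ : ℝ → ℝ) : ℝ :=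
  (∫ z : ℝ × ℝ, (φ (p * z.1 + q * z.2) - φ z.1) ∂((μ : Measure ℝ).prod (μ : Measure ℝ)))
    - (p ^ 2 + q ^ 2 - 1) / 2 * ∫ v, v * deriv φ v ∂(μ : Measure ℝ)

/-- Weak solutions, on `t ≥ 0`, of
`∂ₜ g - ½ (p² + q² - 1) ∂ᵥ(v g) = ∫ (J⁻¹ g(v_*) g(w_*) - g(v) g(w)) dw` with initial datum `f₀`:
weakly continuous curves of probability measures that start at `f₀` and satisfy the weak form
for every smooth compactly supported test function. The values at `t < 0` play no role. -/
structure IsWeakSolution (p q : ℝ) (f₀ : ProbabilityMeasure ℝ)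
    (g : ℝ → ProbabilityMeasure ℝ) : Prop where
  initial : g 0 = f₀
  continuousOn : ContinuousOn g (Set.Ici 0)
  weak_eq : ∀ φ : ℝ → ℝ, ContDiff ℝ ∞ φ → HasCompactSupport φ → ∀ t : ℝ, 0 < t →
    HasDerivAt (fun s => ∫ v, φ v ∂(g s : Measure ℝ)) (weakOp p q (g t) φ) t

/-- Stationary weak solutions of the same equation. -/
def IsStationary (p q : ℝ) (μ : ProbabilityMeasure ℝ) : Prop :=
  ∀ φ : ℝ → ℝ, ContDiff ℝ ∞ φ → HasCompactSupport φ → weakOp p q μ φ = 0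

/-- The Fourier metric `d_s(μ, ν) = sup_{ξ ≠ 0} |μ̂(ξ) - ν̂(ξ)| / |ξ|^s`, with values in `[0, ∞]`.
The sign convention in the exponential of the Fourier transform is immaterial here, because the
supremum runs over all `ξ ≠ 0`. -/
def fourierDist (s : ℝ) (μ ν : ProbabilityMeasure ℝ) : ℝ≥0∞ :=
  ⨆ (ξ : ℝ) (_ : ξ ≠ 0),
    ENNReal.ofReal (‖charFun (μ : Measure ℝ) ξ - charFun (ν : Measure ℝ) ξ‖ / |ξ| ^ s)

/-- The absolute moment `∫ |v|^a μ(dv)`, used only together with its finiteness. -/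
def absMoment (a : ℝ) (μ : ProbabilityMeasure ℝ) : ℝ :=
  ∫ v, |v| ^ a ∂(μ : Measure ℝ)

/-- Finiteness of the absolute moment of order `a`. -/
def HasFiniteMoment (a : ℝ) (μ : ProbabilityMeasure ℝ) : Prop :=
  Integrable (fun v : ℝ => |v| ^ a) (μ : Measure ℝ)

end MaxwellKinetic

end

/-! The drift is only a change of scale. With κ = (p² + q² - 1)/2, dilating `g t` by e^{κt} turns
weak solutions into solutions of the pure collision dynamics (`IsWeakSolution.isCollisionCurve`),
whose characteristic functions satisfy the closed equation ∂ₜu(ξ) = u(pξ)u(qξ) - u(ξ). Since |u| ≤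
1, the difference of two solutions is dominated by solutions of the linear equation ∂ₜB(ξ) = B(pξ) +
B(qξ) - B(ξ) (`IsFourierSolution.norm_sub_le`). Homogeneous data |ξ|^s evolve explicitly, with the
factor e^{(p^s + q^s - 1)t}; undoing the dilation multiplies this by e^{-κst}. For s = 2 the
exponents cancel, and for s = 2 + δ their sum is Σ(δ). This one estimate,
`IsWeakSolution.norm_charFun_sub_le`, gives uniqueness of weak solutions, the contraction in the
Fourier metric, and both halves of the statement on stationary solutions.

Solutions are constructed by the Wild expansion, a convex combination of iterated collisions. It is
a power series in 1 - e^{-t}, so it can be differentiated against unbounded observables as well.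
Mean and energy then obey linear equations, and the moment of order 2 + δ obeys M' ≤ -kM + C, since
the collision gain is at most (p^{2+δ} + q^{2+δ})M plus mixed terms of lower order
(`exists_integral_collide_rpow_le`).

For existence of the stationary law, a solution starting from a Gaussian is compared with its own
time shifts. Normalization and bounded moments keep these within bounded distance of order 2 + η,
with η = min(δ, 1), so contraction makes the characteristic functions Cauchy. The limit is the
transform of a law by tightness, and it is invariant under the flow (`exists_stationary`).
Uniqueness must hold without any moment beyond the second, so the initial difference is split as
ε|ξ|² + b|ξ|^{2+δ}: the flow preserves the first term and destroys the second
(`IsStationary.unique`). -/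

namespace MaxwellKinetic

/-! ### Comparison principle for the equation in Fourier variables -/

/-- The Fourier form of the collision dynamics without drift. -/
structure IsFourierSolution (p q : ℝ) (u : ℝ → ℝ → ℂ) : Prop where
  continuousOn : ∀ ξ, ContinuousOn (fun t => u t ξ) (Set.Ici 0)
  hasDerivAt : ∀ ξ t, 0 < t →
    HasDerivAt (fun s => u s ξ) (u t (p * ξ) * u t (q * ξ) - u t ξ) t
  norm_le_one : ∀ t ξ, 0 ≤ t → ‖u t ξ‖ ≤ 1

theorem le_of_hasDerivAt_nonneg {w w' : ℝ → ℝ} (hc : ContinuousOn w (Set.Ici 0))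
    (hd : ∀ t, 0 < t → HasDerivAt w (w' t) t) (hn : ∀ t, 0 < t → 0 ≤ w' t) {t : ℝ}
    (ht : 0 ≤ t) : w 0 ≤ w t := by
  refine monotoneOn_of_deriv_nonneg (convex_Ici 0) hc ?_ ?_ (Set.mem_Ici.2 le_rfl) ht ht
  · intro x hx
    rw [interior_Ici] at hx
    exact (hd x hx).differentiableAt.differentiableWithinAt
  · intro x hx
    rw [interior_Ici] at hx
    rw [(hd x hx).deriv]
    exact hn x hx

theorem exists_norm_one_mul_eq_norm (z : ℂ) : ∃ c : ℂ, ‖c‖ = 1 ∧ (c * z).re = ‖z‖ := by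
  by_cases h : z = 0
  · exact ⟨1, by simp, by simp [h]⟩
  · have hz : (‖z‖ : ℂ) ≠ 0 := by simpa using h
    refine ⟨starRingEnd ℂ z / ‖z‖, by simp [h], ?_⟩
    have : starRingEnd ℂ z / ‖z‖ * z = (‖z‖ : ℂ) := by
      rw [div_mul_eq_mul_div, mul_comm, Complex.mul_conj, Complex.normSq_eq_norm_sq]
      field_simp
      push_cast
      ring
    rw [this, Complex.ofReal_re]

theorem norm_mul_sub_mul_le {a b c d : ℂ} (hb : ‖b‖ ≤ 1) (hc : ‖c‖ ≤ 1) :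
    ‖a * b - c * d‖ ≤ ‖a - c‖ + ‖b - d‖ := by
  have h : a * b - c * d = (a - c) * b + c * (b - d) := by ring
  rw [h]
  refine (norm_add_le _ _).trans ?_
  rw [norm_mul, norm_mul]
  nlinarith [norm_nonneg (a - c), norm_nonneg (b - d)]

/-- Comparison principle: the distance of two solutions is dominated by every nonnegative solution
of the linear equation that dominates it initially. -/
theorem IsFourierSolution.norm_sub_le {p q : ℝ} {u v : ℝ → ℝ → ℂ}
    (hu : IsFourierSolution p q u) (hv : IsFourierSolution p q v) {B : ℝ → ℝ → ℝ}
    (hB0 : ∀ t ξ, 0 ≤ t → 0 ≤ B t ξ)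
    (hB : ∀ t ξ, HasDerivAt (fun s => B s ξ) (B t (p * ξ) + B t (q * ξ) - B t ξ) t)
    (h0 : ∀ ξ, ‖u 0 ξ - v 0 ξ‖ ≤ B 0 ξ) {t : ℝ} (ht : 0 ≤ t) (ξ : ℝ) :
    ‖u t ξ - v t ξ‖ ≤ B t ξ := by
  -- Picard iteration from the trivial bound 2. The two terms at pξ and qξ double the error at each
  -- round, and integration in time produces the factorial; the error is uniform in ξ, so the
  -- unbounded orbit of ξ under scaling is harmless.
  have key : ∀ n : ℕ, ∀ t ξ, 0 ≤ t →
      ‖u t ξ - v t ξ‖ ≤ B t ξ + 2 * ((2 * t) ^ n / n.factorial) := by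
    intro n
    induction n with
    | zero =>
      intro t ξ ht
      have := _root_.norm_sub_le (u t ξ) (v t ξ)
      have := hu.norm_le_one t ξ ht
      have := hv.norm_le_one t ξ ht
      have := hB0 t ξ ht
      simp only [pow_zero, Nat.factorial_zero, Nat.cast_one, div_one]
      linarith
    | succ n ih =>
      intro t ξ ht
      -- The phase `c` is frozen at the final time: the real part is then differentiable in time, is
      -- always at most the norm, and equals it at `t`.
      obtain ⟨c, hc, hct⟩ := exists_norm_one_mul_eq_norm (u t ξ - v t ξ)
      set e : ℝ → ℝ := fun s => 2 * ((2 * s) ^ (n + 1) / (n + 1).factorial) with he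
      have hed : ∀ s, HasDerivAt e (2 * (2 * ((2 * s) ^ n / n.factorial))) s := by
        intro s
        have h1 : HasDerivAt (fun s : ℝ => 2 * s) 2 s := by
          simpa using (hasDerivAt_id s).const_mul (2 : ℝ)
        have h2 := (((h1.pow (n + 1)).div_const ((n + 1).factorial : ℝ)).const_mul 2)
        refine h2.congr_deriv ?_
        rw [Nat.factorial_succ]
        have : (n.factorial : ℝ) ≠ 0 := by positivity
        push_cast
        field_simp
      -- The factor e^s removes the loss terms, so only the products have to be compared with the
      -- majorant.
      set w : ℝ → ℝ := fun s =>
        Real.exp s * (B s ξ + e s) - Real.exp s * (c * (u s ξ - v s ξ)).re with hw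
      have hwd : ∀ s, 0 < s → HasDerivAt w (Real.exp s * (B s (p * ξ) + B s (q * ξ) +
          2 * (2 * ((2 * s) ^ n / n.factorial)) + e s -
          (c * (u s (p * ξ) * u s (q * ξ) - v s (p * ξ) * v s (q * ξ))).re)) s := by
        intro s hs
        have h1 := (Real.hasDerivAt_exp s).mul ((hB s ξ).add (hed s))
        have h2 := ((hu.hasDerivAt ξ s hs).sub (hv.hasDerivAt ξ s hs)).const_mul c
        have h3 : HasDerivAt (fun s => (c * (u s ξ - v s ξ)).re)
            (c * (u s (p * ξ) * u s (q * ξ) - u s ξ -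
              (v s (p * ξ) * v s (q * ξ) - v s ξ))).re s :=
          (Complex.reCLM.hasFDerivAt.comp_hasDerivAt s h2)
        have h4 := h1.sub ((Real.hasDerivAt_exp s).mul h3)
        refine h4.congr_deriv ?_
        simp only [Complex.mul_re, Complex.sub_re, Complex.sub_im, Pi.add_apply]
        ring
      have hwc : ContinuousOn w (Set.Ici 0) := by
        have hBc : Continuous fun s => B s ξ :=
          continuous_iff_continuousAt.2 fun s => (hB s ξ).continuousAt
        have hec : Continuous e := continuous_iff_continuousAt.2 fun s => (hed s).continuousAt
        have huc := hu.continuousOn ξ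
        have hvc := hv.continuousOn ξ
        refine ((Real.continuous_exp.mul (hBc.add hec)).continuousOn).sub
          (Real.continuous_exp.continuousOn.mul ?_)
        exact Complex.continuous_re.comp_continuousOn (continuousOn_const.mul (huc.sub hvc))
      have hwn : ∀ s, 0 < s → 0 ≤ Real.exp s * (B s (p * ξ) + B s (q * ξ) +
          2 * (2 * ((2 * s) ^ n / n.factorial)) + e s -
          (c * (u s (p * ξ) * u s (q * ξ) - v s (p * ξ) * v s (q * ξ))).re) := by
        intro s hs
        refine mul_nonneg (Real.exp_pos s).le ?_
        have h1 : (c * (u s (p * ξ) * u s (q * ξ) - v s (p * ξ) * v s (q * ξ))).re ≤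
            ‖u s (p * ξ) - v s (p * ξ)‖ + ‖u s (q * ξ) - v s (q * ξ)‖ := by
          refine (Complex.re_le_norm _).trans ?_
          rw [norm_mul, hc, one_mul]
          exact norm_mul_sub_mul_le (hu.norm_le_one _ _ hs.le) (hv.norm_le_one _ _ hs.le)
        have h2 := ih s (p * ξ) hs.le
        have h3 := ih s (q * ξ) hs.le
        have h4 : 0 ≤ e s := by
          simp only [he]
          positivity
        linarith
      have h := le_of_hasDerivAt_nonneg hwc hwd hwn ht
      have hw0 : 0 ≤ w 0 := by
        simp only [hw, he, Real.exp_zero, one_mul, mul_zero, ne_eq, Nat.add_eq_zero_iff,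
          one_ne_zero, and_false, not_false_eq_true, zero_pow, zero_div, add_zero, sub_nonneg]
        refine (Complex.re_le_norm _).trans ?_
        rw [norm_mul, hc, one_mul]
        exact h0 ξ
      have h5 : 0 ≤ Real.exp t * (B t ξ + e t - ‖u t ξ - v t ξ‖) := by
        have : w t = Real.exp t * (B t ξ + e t - ‖u t ξ - v t ξ‖) := by
          simp only [hw, hct]
          ring
        rw [← this]
        exact hw0.trans h
      have := nonneg_of_mul_nonneg_right h5 (Real.exp_pos t)
      linarith
  have hlim : Tendsto (fun n : ℕ => B t ξ + 2 * ((2 * t) ^ n / n.factorial)) atTop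
      (𝓝 (B t ξ + 2 * 0)) :=
    ((FloorSemiring.tendsto_pow_div_factorial_atTop (2 * t)).const_mul 2).const_add _
  rw [mul_zero, add_zero] at hlim
  exact ge_of_tendsto' hlim fun n => key n t ξ ht

/-- Propagation of a bound of the distance by a combination of two homogeneous functions. -/
theorem IsFourierSolution.norm_sub_le_rpow {p q : ℝ} (hp : 0 < p) (hq : 0 < q)
    {u v : ℝ → ℝ → ℂ} (hu : IsFourierSolution p q u) (hv : IsFourierSolution p q v)
    {a b s : ℝ} (ha : 0 ≤ a) (hb : 0 ≤ b)
    (h0 : ∀ ξ, ‖u 0 ξ - v 0 ξ‖ ≤ a * |ξ| ^ (2 : ℝ) + b * |ξ| ^ s) {t : ℝ} (ht : 0 ≤ t) (ξ : ℝ) :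
    ‖u t ξ - v t ξ‖ ≤ a * |ξ| ^ (2 : ℝ) * Real.exp ((p ^ (2 : ℝ) + q ^ (2 : ℝ) - 1) * t) +
      b * |ξ| ^ s * Real.exp ((p ^ s + q ^ s - 1) * t) := by
  refine hu.norm_sub_le hv
    (B := fun t ξ => a * |ξ| ^ (2 : ℝ) * Real.exp ((p ^ (2 : ℝ) + q ^ (2 : ℝ) - 1) * t) +
      b * |ξ| ^ s * Real.exp ((p ^ s + q ^ s - 1) * t)) ?_ ?_ ?_ ht ξ
  · intro t ξ _
    positivity
  · intro t ξ
    have hE : ∀ k : ℝ, HasDerivAt (fun t : ℝ => Real.exp (k * t)) (Real.exp (k * t) * k) t := by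
      intro k
      simpa using ((hasDerivAt_id t).const_mul k).exp
    have hh := ((hE (p ^ (2 : ℝ) + q ^ (2 : ℝ) - 1)).const_mul (a * |ξ| ^ (2 : ℝ))).add
      ((hE (p ^ s + q ^ s - 1)).const_mul (b * |ξ| ^ s))
    refine hh.congr_deriv ?_
    simp only [abs_mul, abs_of_pos hp, abs_of_pos hq, Real.mul_rpow hp.le (abs_nonneg ξ),
      Real.mul_rpow hq.le (abs_nonneg ξ)]
    ring
  · intro ξ
    simpa using h0 ξ

/-! ### Elementary inequalities for powers and for the exponential -/

theorem rpow_two_add_le {x δ η : ℝ} (hx : 0 < x) (hη : 0 ≤ η) (hδ : 0 < δ) (hηδ : η ≤ δ) :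
    x ^ (2 + η) ≤ (1 - η / δ) * x ^ 2 + η / δ * x ^ (2 + δ) := by
  have h1 : η / δ ≤ 1 := (div_le_one hδ).2 hηδ
  have h2 : 0 ≤ η / δ := by positivity
  have h := Real.geom_mean_le_arith_mean2_weighted (sub_nonneg.2 h1) h2
    (by positivity : 0 ≤ x ^ (2 : ℝ)) (by positivity : 0 ≤ x ^ (2 + δ)) (by ring)
  rw [← Real.rpow_mul hx.le, ← Real.rpow_mul hx.le, ← Real.rpow_add hx] at h
  have e : 2 * (1 - η / δ) + (2 + δ) * (η / δ) = 2 + η := by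
    field_simp
    ring
  rwa [e, Real.rpow_two] at h

/-- Σ is convex and vanishes at 0, so Σ(η) ≤ (η/δ) Σ(δ). -/
theorem keyFun_neg {p q δ η : ℝ} (hp : 0 < p) (hq : 0 < q) (hδ : 0 < δ)
    (hneg : keyFun p q δ < 0) (hη : 0 < η) (hηδ : η ≤ δ) : keyFun p q η < 0 := by
  have h1 := rpow_two_add_le hp hη.le hδ hηδ
  have h2 := rpow_two_add_le hq hη.le hδ hηδ
  have h3 : keyFun p q η ≤ η / δ * keyFun p q δ := by
    unfold keyFun
    have e : η / δ * δ = η := div_mul_cancel₀ η hδ.ne'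
    linear_combination h1 + h2 + (p ^ 2 + q ^ 2 - 1) / 2 * e
  exact h3.trans_lt (mul_neg_of_pos_of_neg (by positivity) hneg)

/-- For y ≤ x, Bernoulli's inequality at 1 - y/(x+y) gives (x+y)^s ≤ x^s + s y (x+y)^{s-1}, and x +
y ≤ 2x. What matters is that the pure powers keep coefficient one, so that the moment estimate
retains p^s + q^s. -/
theorem add_rpow_le {x y s : ℝ} (hx : 0 ≤ x) (hy : 0 ≤ y) (hs : 1 ≤ s) :
    (x + y) ^ s ≤ x ^ s + y ^ s + s * 2 ^ s * (x ^ (s - 1) * y + y ^ (s - 1) * x) := by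
  wlog hxy : y ≤ x generalizing x y
  · have := this hy hx (not_le.1 hxy).le
    rw [add_comm x y]
    linarith
  rcases hx.eq_or_lt with rfl | hx0
  · have : y = 0 := le_antisymm hxy hy
    subst this
    have h0 : (0 : ℝ) ^ s = 0 := Real.zero_rpow (by linarith)
    simp [h0]
  have hb := one_add_mul_self_le_rpow_one_add (s := -(y / (x + y))) (p := s) (by
    rw [neg_le_neg_iff, div_le_one (by linarith)]
    linarith) hs
  have hxy0 : 0 < x + y := by linarith
  have e1 : 1 + -(y / (x + y)) = x / (x + y) := by
    field_simp
    ring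
  rw [e1, Real.div_rpow hx hxy0.le, le_div_iff₀ (Real.rpow_pos_of_pos hxy0 s)] at hb
  have e2 : (x + y) ^ s = (x + y) ^ (s - 1) * (x + y) := by
    rw [← Real.rpow_add_one hxy0.ne']
    ring_nf
  have h1 : (x + y) ^ s ≤ x ^ s + s * y * (x + y) ^ (s - 1) := by
    have : (1 + s * -(y / (x + y))) * (x + y) ^ s =
        (x + y) ^ s - s * y * (x + y) ^ (s - 1) := by
      rw [e2]
      field_simp
      ring
    linarith
  have h2 : (x + y) ^ (s - 1) ≤ 2 ^ s * x ^ (s - 1) := by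
    calc (x + y) ^ (s - 1) ≤ (2 * x) ^ (s - 1) :=
          Real.rpow_le_rpow hxy0.le (by linarith) (by linarith)
      _ = 2 ^ (s - 1) * x ^ (s - 1) := Real.mul_rpow (by norm_num) hx
      _ ≤ 2 ^ s * x ^ (s - 1) := by
          gcongr
          · norm_num
          · linarith
  have h3 : 0 ≤ y ^ s := by positivity
  have h4 : 0 ≤ s * 2 ^ s * (y ^ (s - 1) * x) := by positivity
  have h5 : s * y * (x + y) ^ (s - 1) ≤ s * y * (2 ^ s * x ^ (s - 1)) := by gcongr
  nlinarith

/-- Inside the unit interval the cubic remainder suffices because η ≤ 1; outside, every term is at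
most a multiple of x². -/
theorem norm_exp_sub_taylor_two_le {η : ℝ} (hη : 0 ≤ η) (hη1 : η ≤ 1) (x : ℝ) :
    ‖Complex.exp (x * Complex.I) - 1 - x * Complex.I + x ^ 2 / 2‖ ≤ 4 * |x| ^ (2 + η) := by
  rcases le_or_gt |x| 1 with hx | hx
  · have h := Complex.exp_bound (x := x * Complex.I) (by simpa using hx) (n := 3) (by norm_num)
    have e : ∑ m ∈ Finset.range 3, ((x : ℂ) * Complex.I) ^ m / (m.factorial : ℂ) =
        1 + x * Complex.I - x ^ 2 / 2 := by
      simp [Finset.sum_range_succ, mul_pow, Complex.I_sq]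
      ring
    rw [e] at h
    have e2 : Complex.exp (x * Complex.I) - 1 - x * Complex.I + x ^ 2 / 2 =
        Complex.exp (x * Complex.I) - (1 + x * Complex.I - x ^ 2 / 2) := by ring
    rw [e2]
    refine h.trans ?_
    simp only [norm_mul, Complex.norm_real, Complex.norm_I, mul_one, Real.norm_eq_abs]
    have h3 : |x| ^ 3 ≤ |x| ^ (2 + η) := by
      rcases (abs_nonneg x).eq_or_lt with h0 | h0
      · rw [← h0]
        simpa using Real.rpow_nonneg le_rfl _
      · rw [← Real.rpow_natCast]
        exact Real.rpow_le_rpow_of_exponent_ge h0 hx (by push_cast; linarith)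
    have h4 : (((3 : ℕ).succ : ℝ) * (((3 : ℕ).factorial : ℝ) * ((3 : ℕ) : ℝ))⁻¹) ≤ 4 := by
      norm_num [Nat.factorial]
    calc _ ≤ |x| ^ 3 * 4 := by gcongr
      _ ≤ _ := by linarith
  · have h1 : ‖Complex.exp (x * Complex.I) - 1 - x * Complex.I + x ^ 2 / 2‖ ≤
        1 + 1 + |x| + |x| ^ 2 / 2 := by
      refine (norm_add_le _ _).trans (add_le_add ((norm_sub_le _ _).trans (add_le_add
        ((norm_sub_le _ _).trans (add_le_add ?_ ?_)) ?_)) ?_)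
      · rw [Complex.norm_exp_ofReal_mul_I]
      · simp
      · simp
      · simp
    have h2 : |x| ^ 2 ≤ |x| ^ (2 + η) := by
      rw [← Real.rpow_natCast]
      exact Real.rpow_le_rpow_of_exponent_le hx.le (by push_cast; linarith)
    nlinarith

end MaxwellKinetic

/-! ### The Wild expansion -/

noncomputable section

namespace MaxwellKinetic

/-- The law of `p X + q Y` for independent `X` and `Y` with laws `μ` and `ν`. -/
def collide (p q : ℝ) (μ ν : Measure ℝ) : Measure ℝ :=
  (μ.prod ν).map fun z => p * z.1 + q * z.2

theorem measurable_collision (p q : ℝ) : Measurable fun z : ℝ × ℝ => p * z.1 + q * z.2 := by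
  fun_prop

instance (p q : ℝ) (μ ν : Measure ℝ) [IsProbabilityMeasure μ] [IsProbabilityMeasure ν] :
    IsProbabilityMeasure (collide p q μ ν) :=
  Measure.isProbabilityMeasure_map (measurable_collision p q).aemeasurable

/-- The terms of the Wild expansion. -/
def wild (p q : ℝ) (μ : Measure ℝ) : ℕ → Measure ℝ
  | 0 => μ
  | n + 1 => ((n : ℝ≥0∞) + 1)⁻¹ •
      ∑ k : Fin (n + 1), collide p q (wild p q μ k) (wild p q μ (n - k))
  decreasing_by
    · exact k.2
    · omega

theorem wild_succ (p q : ℝ) (μ : Measure ℝ) (n : ℕ) :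
    ((n : ℝ≥0∞) + 1) • wild p q μ (n + 1) =
      ∑ x ∈ Finset.HasAntidiagonal.antidiagonal n, collide p q (wild p q μ x.1) (wild p q μ x.2) := by
  rw [wild, smul_smul, ENNReal.mul_inv_cancel (by simp) (by finiteness), one_smul,
    Finset.Nat.sum_antidiagonal_eq_sum_range_succ
      (fun i j => collide p q (wild p q μ i) (wild p q μ j)),
    ← Fin.sum_univ_eq_sum_range (fun k => collide p q (wild p q μ k) (wild p q μ (n - k)))]

variable {p q : ℝ} {μ : Measure ℝ}

theorem wild_apply_univ [IsProbabilityMeasure μ] (n : ℕ) : wild p q μ n Set.univ = 1 := by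
  induction n using Nat.strong_induction_on with
  | _ n ih =>
    match n, ih with
    | 0, _ => simp [wild]
    | n + 1, ih =>
      have h1 : ∀ k : Fin (n + 1),
          collide p q (wild p q μ k) (wild p q μ (n - k)) Set.univ = 1 := by
        intro k
        have : IsProbabilityMeasure (wild p q μ k) := ⟨ih k k.2⟩
        have : IsProbabilityMeasure (wild p q μ (n - k)) := ⟨ih _ (by omega)⟩
        exact measure_univ
      rw [wild]
      simp only [Measure.smul_apply, Measure.coe_finsetSum, Finset.sum_apply, h1,
        Finset.sum_const, Finset.card_univ, Fintype.card_fin, smul_eq_mul, nsmul_eq_mul, mul_one]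
      push_cast
      exact ENNReal.inv_mul_cancel (by simp) (by finiteness)

instance [IsProbabilityMeasure μ] (n : ℕ) : IsProbabilityMeasure (wild p q μ n) :=
  ⟨wild_apply_univ n⟩

/-- The sum of the Wild expansion. -/
def wildSum (p q : ℝ) (μ : Measure ℝ) (y : ℝ) : Measure ℝ :=
  Measure.sum fun n => ENNReal.ofReal ((1 - y) * y ^ n) • wild p q μ n

theorem isProbabilityMeasure_wildSum [IsProbabilityMeasure μ] {y : ℝ} (hy : 0 ≤ y) (hy1 : y < 1) :
    IsProbabilityMeasure (wildSum p q μ y) := by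
  constructor
  have h0 : 0 ≤ 1 - y := by linarith
  simp only [wildSum, Measure.sum_apply _ MeasurableSet.univ, Measure.smul_apply, measure_univ,
    smul_eq_mul, mul_one]
  rw [← ENNReal.ofReal_tsum_of_nonneg (fun n => by positivity)
    ((summable_geometric_of_lt_one hy hy1).mul_left _), tsum_mul_left,
    tsum_geometric_of_lt_one hy hy1, mul_inv_cancel₀ (by linarith), ENNReal.ofReal_one]

/-- A Cauchy product regrouped along antidiagonals. With F(y) = ∑ yⁿ μₙ, where μₙ are the Wild
terms, it says that colliding F with itself gives F'(y), which is why the recursion carries the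
weight 1/(n+1). -/
theorem collide_wildSum [IsProbabilityMeasure μ] {y : ℝ} (hy : 0 ≤ y) (hy1 : y < 1) :
    collide p q (wildSum p q μ y) (wildSum p q μ y) =
      Measure.sum fun n : ℕ => ENNReal.ofReal ((1 - y) ^ 2 * y ^ n) •
        (((n : ℝ≥0∞) + 1) • wild p q μ (n + 1)) := by
  have h0 : 0 ≤ 1 - y := by linarith
  ext s hs
  simp only [wild_succ]
  rw [collide, wildSum, Measure.prod_sum, Measure.map_sum (measurable_collision p q).aemeasurable,
    Measure.sum_apply _ hs, Measure.sum_apply _ hs,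
    ← Finset.HasAntidiagonal.sigmaAntidiagonalEquivProd.tsum_eq, ENNReal.tsum_sigma']
  refine tsum_congr fun n => ?_
  rw [tsum_fintype]
  simp only [Finset.HasAntidiagonal.sigmaAntidiagonalEquivProd_apply, Measure.smul_apply,
    Measure.coe_finsetSum, Finset.sum_apply, smul_eq_mul, Finset.mul_sum]
  rw [Finset.sum_coe_sort (Finset.HasAntidiagonal.antidiagonal n) (fun x =>
    (Measure.map (fun z : ℝ × ℝ => p * z.1 + q * z.2)
      ((ENNReal.ofReal ((1 - y) * y ^ x.1) • wild p q μ x.1).prod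
        (ENNReal.ofReal ((1 - y) * y ^ x.2) • wild p q μ x.2))) s)]
  refine Finset.sum_congr rfl fun x hx => ?_
  rw [Finset.HasAntidiagonal.mem_antidiagonal] at hx
  rw [Measure.prod_smul_left, Measure.prod_smul_right, Measure.map_smul, Measure.map_smul,
    Measure.smul_apply, Measure.smul_apply, smul_eq_mul, smul_eq_mul, ← mul_assoc,
    ← ENNReal.ofReal_mul (by positivity), collide]
  congr 2
  rw [← hx]
  ring

variable {E : Type*} [NormedAddCommGroup E]

/-- Trades the factor n + 1 created by differentiation for a slightly larger radius `R`. -/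
theorem succ_mul_pow_mul_sub_le {r R : ℝ} (hr : 0 ≤ r) (hR : r ≤ R) (n : ℕ) :
    (n + 1) * r ^ n * (R - r) ≤ R ^ (n + 1) - r ^ (n + 1) := by
  induction n with
  | zero => simp
  | succ n ih =>
    have h1 : r ^ (n + 1) ≤ R ^ (n + 1) := by gcongr
    have h2 := mul_le_mul_of_nonneg_left ih hr
    have h3 := mul_le_mul_of_nonneg_right h1 (sub_nonneg.2 hR)
    push_cast
    calc _ = r * ((n + 1) * r ^ n * (R - r)) + r ^ (n + 1) * (R - r) := by ring
      _ ≤ r * (R ^ (n + 1) - r ^ (n + 1)) + r ^ (n + 1) * (R - r) := by linarith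
      _ ≤ r * (R ^ (n + 1) - r ^ (n + 1)) + R ^ (n + 1) * (R - r) := by linarith
      _ = _ := by ring

theorem hasDerivAt_tsum_pow_smul [NormedSpace ℝ E] [CompleteSpace E] {a : ℕ → E}
    (h : ∀ y : ℝ, 0 ≤ y → y < 1 → Summable fun n => y ^ n * ‖a n‖) {y : ℝ} (hy : |y| < 1) :
    HasDerivAt (fun z : ℝ => ∑' n, z ^ n • a n)
      (∑' n : ℕ, (((n : ℝ) + 1) * y ^ n) • a (n + 1)) y := by
  obtain ⟨r, hyr, hr1⟩ := exists_between hy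
  obtain ⟨R, hrR, hR1⟩ := exists_between hr1
  have hr0 : 0 ≤ r := (abs_nonneg y).trans hyr.le
  set u : ℕ → ℝ := fun n => (n : ℝ) * r ^ (n - 1) * ‖a n‖ with hu
  have hus : Summable u := by
    refine (summable_nat_add_iff 1).1 ?_
    have h2 := ((summable_nat_add_iff 1).2 (h R (hr0.trans hrR.le) hR1)).mul_left (R - r)⁻¹
    refine Summable.of_nonneg_of_le (fun n => by positivity) (fun n => ?_) h2
    have h3 := succ_mul_pow_mul_sub_le hr0 hrR.le n
    have h4 : ((n : ℝ) + 1) * r ^ n ≤ (R - r)⁻¹ * R ^ (n + 1) := by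
      rw [inv_mul_eq_div, le_div_iff₀ (sub_pos.2 hrR)]
      have : 0 ≤ r ^ (n + 1) := by positivity
      linarith
    simp only [hu, Nat.add_sub_cancel, Nat.cast_add, Nat.cast_one]
    rw [← mul_assoc]
    gcongr
  have hsum : Summable fun n : ℕ => ‖((n : ℝ) * y ^ (n - 1)) • a n‖ := by
    refine Summable.of_nonneg_of_le (fun n => norm_nonneg _) (fun n => ?_) hus
    rw [norm_smul, norm_mul, norm_pow, Real.norm_natCast, Real.norm_eq_abs]
    simp only [hu]
    gcongr
  have hd := hasDerivAt_tsum_of_isPreconnected (𝕜 := ℝ) (g := fun n z => z ^ n • a n)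
    (g' := fun n z => ((n : ℝ) * z ^ (n - 1)) • a n) (u := u) (t := Metric.ball (0 : ℝ) r)
    (y₀ := y) (y := y) hus Metric.isOpen_ball (convex_ball 0 r).isPreconnected
    (fun n z _ => (hasDerivAt_pow n z).smul_const (a n))
    (fun n z hz => by
      rw [mem_ball_zero_iff, Real.norm_eq_abs] at hz
      rw [norm_smul, norm_mul, norm_pow, Real.norm_natCast, Real.norm_eq_abs]
      simp only [hu]
      gcongr)
    (by rwa [mem_ball_zero_iff, Real.norm_eq_abs])
    (by
      refine Summable.of_norm ?_
      simpa [norm_smul] using h |y| (abs_nonneg y) hy)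
    (by rwa [mem_ball_zero_iff, Real.norm_eq_abs])
  refine hd.congr_deriv ?_
  rw [hsum.of_norm.tsum_eq_zero_add]
  simp

/-- Integrability of an observable along the Wild expansion. -/
def WildIntegrable (p q : ℝ) (μ : Measure ℝ) (φ : ℝ → E) : Prop :=
  ∀ y : ℝ, 0 ≤ y → y < 1 → Integrable φ (wildSum p q μ y)

theorem WildIntegrable.wild {φ : ℝ → E} (h : WildIntegrable p q μ φ) (n : ℕ) :
    Integrable φ (wild p q μ n) := by
  have h1 := (h (1 / 2) (by norm_num) (by norm_num)).mono_measure (Measure.le_sum _ n)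
  rwa [integrable_smul_measure] at h1
  · rw [ne_eq, ENNReal.ofReal_eq_zero, not_le]
    positivity
  · exact ENNReal.ofReal_ne_top

theorem WildIntegrable.summable {φ : ℝ → E} (h : WildIntegrable p q μ φ) {y : ℝ} (hy : 0 ≤ y)
    (hy1 : y < 1) : Summable fun n => y ^ n * ∫ v, ‖φ v‖ ∂MaxwellKinetic.wild p q μ n := by
  have h0 : 0 < 1 - y := by linarith
  have h1 := (integrable_sum_measure_iff.1 (h y hy hy1)).2
  have h2 := h1.mul_left (1 - y)⁻¹
  refine h2.congr fun n => ?_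
  rw [integral_smul_measure, ENNReal.toReal_ofReal (by positivity), smul_eq_mul]
  field_simp

theorem WildIntegrable.summable_norm_integral [NormedSpace ℝ E] {φ : ℝ → E} (h : WildIntegrable p q μ φ) {y : ℝ}
    (hy : 0 ≤ y) (hy1 : y < 1) :
    Summable fun n => y ^ n * ‖∫ v, φ v ∂MaxwellKinetic.wild p q μ n‖ :=
  Summable.of_nonneg_of_le (fun n => by positivity)
    (fun n => by gcongr; exact norm_integral_le_integral_norm _) (h.summable hy hy1)

theorem WildIntegrable.integral_wildSum [NormedSpace ℝ E] {φ : ℝ → E} (h : WildIntegrable p q μ φ)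
    {y : ℝ} (hy : 0 ≤ y) (hy1 : y < 1) : ∫ v, φ v ∂wildSum p q μ y =
      (1 - y) • ∑' n, y ^ n • ∫ v, φ v ∂MaxwellKinetic.wild p q μ n := by
  have h0 : 0 < 1 - y := by linarith
  have h1 := integral_sum_measure (h y hy hy1)
  rw [← tsum_const_smul'', wildSum, h1]
  refine tsum_congr fun n => ?_
  rw [integral_smul_measure, ENNReal.toReal_ofReal (by positivity), smul_smul]

/-- Integrability at every y < 1 means radius of convergence at least one, so the differentiated
series also converges; no growth condition on `φ` is needed. -/
theorem WildIntegrable.integrable_collide [IsProbabilityMeasure μ] [NormedSpace ℝ E] [CompleteSpace E] {φ : ℝ → E}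
    (h : WildIntegrable p q μ φ) {y : ℝ} (hy : 0 ≤ y) (hy1 : y < 1) :
    Integrable φ (collide p q (wildSum p q μ y) (wildSum p q μ y)) := by
  have h0 : 0 < 1 - y := by linarith
  rw [collide_wildSum hy hy1, integrable_sum_measure_iff]
  constructor
  · intro n
    exact ((h.wild (n + 1)).smul_measure (by finiteness)).smul_measure (by finiteness)
  · obtain ⟨R, hyR, hR1⟩ := exists_between hy1
    have hR := ((summable_nat_add_iff 1).2 (h.summable (hy.trans hyR.le) hR1)).mul_left
      ((1 - y) ^ 2 * (R - y)⁻¹)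
    refine Summable.of_nonneg_of_le (fun n => by positivity) (fun n => ?_) hR
    rw [integral_smul_measure, integral_smul_measure, ENNReal.toReal_ofReal (by positivity)]
    have h3 := succ_mul_pow_mul_sub_le hy hyR.le n
    have h4 : ((n : ℝ) + 1) * y ^ n ≤ (R - y)⁻¹ * R ^ (n + 1) := by
      rw [inv_mul_eq_div, le_div_iff₀ (sub_pos.2 hyR)]
      have : 0 ≤ y ^ (n + 1) := by positivity
      linarith
    have h5 : ((n : ℝ≥0∞) + 1).toReal = n + 1 := by
      rw [ENNReal.toReal_add (by simp) (by simp)]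
      simp
    rw [h5, smul_eq_mul, smul_eq_mul, ← mul_assoc, ← mul_assoc]
    refine mul_le_mul_of_nonneg_right ?_ (integral_nonneg fun v => norm_nonneg _)
    calc (1 - y) ^ 2 * y ^ n * (n + 1) = (1 - y) ^ 2 * ((n + 1) * y ^ n) := by ring
      _ ≤ (1 - y) ^ 2 * ((R - y)⁻¹ * R ^ (n + 1)) := by gcongr
      _ = _ := by ring

theorem WildIntegrable.integral_collide [IsProbabilityMeasure μ] [NormedSpace ℝ E] [CompleteSpace E] {φ : ℝ → E}
    (h : WildIntegrable p q μ φ) {y : ℝ} (hy : 0 ≤ y) (hy1 : y < 1) :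
    ∫ v, φ v ∂collide p q (wildSum p q μ y) (wildSum p q μ y) =
      (1 - y) ^ 2 • ∑' n : ℕ, (((n : ℝ) + 1) * y ^ n) •
        ∫ v, φ v ∂MaxwellKinetic.wild p q μ (n + 1) := by
  have h0 : 0 < 1 - y := by linarith
  have hi := h.integrable_collide hy hy1
  rw [collide_wildSum hy hy1] at hi ⊢
  rw [integral_sum_measure hi, ← tsum_const_smul'']
  refine tsum_congr fun n => ?_
  have h5 : ((n : ℝ≥0∞) + 1).toReal = n + 1 := by
    rw [ENNReal.toReal_add (by simp) (by simp)]
    simp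
  rw [integral_smul_measure, integral_smul_measure, ENNReal.toReal_ofReal (by positivity), h5,
    smul_smul, smul_smul]
  congr 1
  ring

/-- The solution of the collision dynamics without drift that starts at `f₀`. -/
def wildCurve (p q : ℝ) (f₀ : ProbabilityMeasure ℝ) (t : ℝ) : ProbabilityMeasure ℝ :=
  ⟨wildSum p q f₀ (1 - Real.exp (-max t 0)), isProbabilityMeasure_wildSum
    (by simp) (by linarith [Real.exp_pos (-max t 0)])⟩

theorem wildCurve_coe (f₀ : ProbabilityMeasure ℝ) {t : ℝ} (ht : 0 ≤ t) :
    (wildCurve p q f₀ t : Measure ℝ) = wildSum p q f₀ (1 - Real.exp (-t)) := by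
  simp [wildCurve, max_eq_left ht]

theorem wildCurve_zero (f₀ : ProbabilityMeasure ℝ) : wildCurve p q f₀ 0 = f₀ := by
  refine Subtype.ext (Measure.ext fun s hs => ?_)
  change (wildCurve p q f₀ 0 : Measure ℝ) s = (f₀ : Measure ℝ) s
  rw [wildCurve_coe f₀ le_rfl, wildSum, Measure.sum_apply _ hs, tsum_eq_single 0]
  · simp [wild]
  · intro n hn
    simp [hn]

theorem WildIntegrable.integrable_wildCurve {f₀ : ProbabilityMeasure ℝ} {φ : ℝ → E}
    (h : WildIntegrable p q f₀ φ) (t : ℝ) : Integrable φ (wildCurve p q f₀ t : Measure ℝ) :=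
  h _ (by simp) (by linarith [Real.exp_pos (-max t 0)])

theorem WildIntegrable.integral_wildCurve [NormedSpace ℝ E] {f₀ : ProbabilityMeasure ℝ} {φ : ℝ → E}
    (h : WildIntegrable p q f₀ φ) {t : ℝ} (ht : 0 ≤ t) :
    ∫ v, φ v ∂(wildCurve p q f₀ t : Measure ℝ) = Real.exp (-t) •
      ∑' n, (1 - Real.exp (-t)) ^ n • ∫ v, φ v ∂MaxwellKinetic.wild p q f₀ n := by
  rw [wildCurve_coe f₀ ht, h.integral_wildSum (by simpa) (by linarith [Real.exp_pos (-t)]),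
    sub_sub_cancel]

/-- By the product and chain rules, (e^{-t} F(1 - e^{-t}))' = -e^{-t}F + e^{-2t}F'. The series,
unlike `wildCurve`, is not frozen for negative times, so it is differentiable at t = 0 too; this
yields continuity up to the initial time. -/
theorem WildIntegrable.hasDerivAt_aux [NormedSpace ℝ E] [CompleteSpace E] {f₀ : ProbabilityMeasure ℝ} {φ : ℝ → E}
    (h : WildIntegrable p q f₀ φ) {t : ℝ} (ht : 0 ≤ t) :
    HasDerivAt (fun s : ℝ => Real.exp (-s) •
      ∑' n, (1 - Real.exp (-s)) ^ n • ∫ v, φ v ∂MaxwellKinetic.wild p q f₀ n)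
      (∫ v, φ v ∂collide p q (wildCurve p q f₀ t) (wildCurve p q f₀ t) -
        ∫ v, φ v ∂(wildCurve p q f₀ t : Measure ℝ)) t := by
  have h0 : 0 ≤ 1 - Real.exp (-t) := by simpa
  have h1 : 1 - Real.exp (-t) < 1 := by linarith [Real.exp_pos (-t)]
  have hF := hasDerivAt_tsum_pow_smul (fun y hy hy1 => h.summable_norm_integral hy hy1)
    (y := 1 - Real.exp (-t)) (by rwa [abs_of_nonneg h0])
  have hE : HasDerivAt (fun s : ℝ => Real.exp (-s)) (-Real.exp (-t)) t := by
    simpa using (hasDerivAt_neg t).exp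
  have hY : HasDerivAt (fun s : ℝ => 1 - Real.exp (-s)) (Real.exp (-t)) t := by
    simpa using hE.const_sub 1
  have hFY := hF.scomp t hY
  refine (hE.smul hFY).congr_deriv ?_
  rw [h.integral_wildCurve ht, wildCurve_coe f₀ ht, h.integral_collide h0 h1, sub_sub_cancel,
    smul_smul, ← sq, neg_smul, ← sub_eq_add_neg]
  rfl

theorem WildIntegrable.hasDerivAt [NormedSpace ℝ E] [CompleteSpace E] {f₀ : ProbabilityMeasure ℝ} {φ : ℝ → E}
    (h : WildIntegrable p q f₀ φ) {t : ℝ} (ht : 0 < t) :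
    HasDerivAt (fun s : ℝ => ∫ v, φ v ∂(wildCurve p q f₀ s : Measure ℝ))
      (∫ v, φ v ∂collide p q (wildCurve p q f₀ t) (wildCurve p q f₀ t) -
        ∫ v, φ v ∂(wildCurve p q f₀ t : Measure ℝ)) t := by
  refine (h.hasDerivAt_aux ht.le).congr_of_eventuallyEq ?_
  filter_upwards [eventually_ge_nhds ht] with s hs
  exact h.integral_wildCurve hs

theorem WildIntegrable.continuousOn [NormedSpace ℝ E] [CompleteSpace E] {f₀ : ProbabilityMeasure ℝ} {φ : ℝ → E}
    (h : WildIntegrable p q f₀ φ) :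
    ContinuousOn (fun s : ℝ => ∫ v, φ v ∂(wildCurve p q f₀ s : Measure ℝ)) (Set.Ici 0) := by
  refine ContinuousOn.congr (f := fun s : ℝ => Real.exp (-s) •
      ∑' n, (1 - Real.exp (-s)) ^ n • ∫ v, φ v ∂MaxwellKinetic.wild p q f₀ n) ?_ ?_
  · exact fun t ht => (h.hasDerivAt_aux ht).continuousAt.continuousWithinAt
  · exact fun t ht => h.integral_wildCurve ht

theorem wildIntegrable_of_bounded [IsProbabilityMeasure μ] {φ : ℝ → E}
    (hφ : StronglyMeasurable φ) {C : ℝ} (hC : ∀ v, ‖φ v‖ ≤ C) : WildIntegrable p q μ φ := by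
  intro y hy hy1
  have := isProbabilityMeasure_wildSum (p := p) (q := q) (μ := μ) hy hy1
  exact Integrable.of_bound hφ.aestronglyMeasurable C (ae_of_all _ hC)

theorem continuousOn_wildCurve (f₀ : ProbabilityMeasure ℝ) :
    ContinuousOn (wildCurve p q f₀) (Set.Ici 0) := by
  intro t ht
  rw [ContinuousWithinAt, ProbabilityMeasure.tendsto_iff_forall_integral_tendsto]
  intro φ
  exact (wildIntegrable_of_bounded φ.continuous.stronglyMeasurable φ.norm_coe_le_norm).continuousOn
    t ht

/-! ### Moments along the Wild expansion -/

theorem abs_collision_rpow_le {s : ℝ} (hs : 0 ≤ s) (hp : 0 ≤ p) (hq : 0 ≤ q) (v w : ℝ) :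
    |p * v + q * w| ^ s ≤ (p + q) ^ s * (|v| ^ s + |w| ^ s) := by
  have h1 : |p * v + q * w| ≤ (p + q) * max |v| |w| := by
    refine (abs_add_le _ _).trans ?_
    rw [abs_mul, abs_mul, abs_of_nonneg hp, abs_of_nonneg hq, add_mul]
    gcongr
    · exact le_max_left _ _
    · exact le_max_right _ _
  have h2 : (max |v| |w|) ^ s ≤ |v| ^ s + |w| ^ s := by
    have := Real.rpow_nonneg (abs_nonneg v) s
    have := Real.rpow_nonneg (abs_nonneg w) s
    rcases max_choice |v| |w| with h | h <;> rw [h] <;> linarith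
  calc _ ≤ ((p + q) * max |v| |w|) ^ s := by gcongr
    _ = (p + q) ^ s * (max |v| |w|) ^ s :=
        Real.mul_rpow (by positivity) (le_max_of_le_left (abs_nonneg v))
    _ ≤ _ := by gcongr

theorem lintegral_collide_rpow_le {s : ℝ} (hs : 0 ≤ s) (hp : 0 ≤ p) (hq : 0 ≤ q)
    (μ ν : Measure ℝ) [IsProbabilityMeasure μ] [IsProbabilityMeasure ν] :
    ∫⁻ v, ENNReal.ofReal (|v| ^ s) ∂collide p q μ ν ≤ ENNReal.ofReal ((p + q) ^ s) *
      (∫⁻ v, ENNReal.ofReal (|v| ^ s) ∂μ + ∫⁻ v, ENNReal.ofReal (|v| ^ s) ∂ν) := by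
  have hm : Measurable fun v : ℝ => ENNReal.ofReal (|v| ^ s) := by fun_prop
  rw [collide, lintegral_map hm (measurable_collision p q)]
  calc _ ≤ ∫⁻ z : ℝ × ℝ, ENNReal.ofReal ((p + q) ^ s) *
        (ENNReal.ofReal (|z.1| ^ s) + ENNReal.ofReal (|z.2| ^ s)) ∂μ.prod ν := by
        refine lintegral_mono fun z => ?_
        rw [← ENNReal.ofReal_add (by positivity) (by positivity),
          ← ENNReal.ofReal_mul (by positivity)]
        exact ENNReal.ofReal_le_ofReal (abs_collision_rpow_le hs hp hq _ _)
    _ = _ := by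
        rw [lintegral_const_mul _ (by fun_prop), lintegral_add_left (by fun_prop),
          lintegral_prod _ (by fun_prop), lintegral_prod_symm _ (by fun_prop)]
        simp

/-- Summing the recursion over an antidiagonal counts each earlier moment twice, so the partial sums
grow by a factor of at most 1 + 2(p+q)^s/(n+1). Lower integrals are used because finiteness is part
of what is being proved. -/
theorem lintegral_wild_rpow_le [IsProbabilityMeasure μ] {s : ℝ} (hs : 0 ≤ s) (hp : 0 ≤ p)
    (hq : 0 ≤ q) {P : ℕ → ℝ} (hP : ∀ n, 0 ≤ P n)
    (h0 : ∫⁻ v, ENNReal.ofReal (|v| ^ s) ∂μ ≤ ENNReal.ofReal (P 0))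
    (hsucc : ∀ n : ℕ, P (n + 1) = (1 + 2 * (p + q) ^ s / (n + 1)) * P n) (n : ℕ) :
    ∑ k ∈ Finset.range (n + 1), ∫⁻ v, ENNReal.ofReal (|v| ^ s) ∂wild p q μ k ≤
      ENNReal.ofReal (P n) := by
  set L : ℕ → ℝ≥0∞ := fun k => ∫⁻ v, ENNReal.ofReal (|v| ^ s) ∂wild p q μ k with hL
  induction n with
  | zero => simpa [wild, hL] using h0
  | succ n ih =>
    rw [Finset.sum_range_succ]
    set S := ∑ k ∈ Finset.range (n + 1), L k with hS
    have h1 : ((n : ℝ≥0∞) + 1) * L (n + 1) ≤ ENNReal.ofReal ((p + q) ^ s) * (S + S) := by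
      calc ((n : ℝ≥0∞) + 1) * L (n + 1)
          = ∫⁻ v, ENNReal.ofReal (|v| ^ s) ∂(((n : ℝ≥0∞) + 1) • wild p q μ (n + 1)) := by
            rw [lintegral_smul_measure, smul_eq_mul]
        _ = ∑ x ∈ Finset.HasAntidiagonal.antidiagonal n, ∫⁻ v, ENNReal.ofReal (|v| ^ s)
              ∂collide p q (wild p q μ x.1) (wild p q μ x.2) := by
            rw [wild_succ, lintegral_finsetSum_measure]
        _ ≤ ∑ x ∈ Finset.HasAntidiagonal.antidiagonal n, ENNReal.ofReal ((p + q) ^ s) * (L x.1 + L x.2) :=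
            Finset.sum_le_sum fun x _ => lintegral_collide_rpow_le hs hp hq _ _
        _ = _ := by
            rw [← Finset.mul_sum, Finset.sum_add_distrib]
            congr 2
            · rw [Finset.Nat.sum_antidiagonal_eq_sum_range_succ_mk]
            · rw [← Finset.Nat.sum_antidiagonal_swap,
                Finset.Nat.sum_antidiagonal_eq_sum_range_succ_mk]
              simp [hS]
    have h2 : ENNReal.ofReal ((p + q) ^ s) * (S + S) ≤
        ENNReal.ofReal ((n + 1) * (2 * (p + q) ^ s / (n + 1) * P n)) := by
      calc _ ≤ ENNReal.ofReal ((p + q) ^ s) * (ENNReal.ofReal (P n) + ENNReal.ofReal (P n)) := by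
            gcongr
        _ = _ := by
            rw [← ENNReal.ofReal_add (hP n) (hP n), ← ENNReal.ofReal_mul (by positivity)]
            congr 1
            field_simp
            ring
    have h3 : L (n + 1) ≤ ENNReal.ofReal (2 * (p + q) ^ s / (n + 1) * P n) := by
      have h4 := h1.trans h2
      rw [ENNReal.ofReal_mul (by positivity)] at h4
      have h5 : ENNReal.ofReal ((n : ℝ) + 1) = (n : ℝ≥0∞) + 1 := by
        rw [ENNReal.ofReal_add (by positivity) (by norm_num)]
        simp
      rw [h5] at h4
      exact (ENNReal.mul_le_mul_iff_right (by simp) (by finiteness)).1 h4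
    rw [hsucc, add_mul, one_mul, ENNReal.ofReal_add (hP n)
      (mul_nonneg (by positivity) (hP n))]
    exact add_le_add ih h3

theorem wildIntegrable_abs_rpow [IsProbabilityMeasure μ] {s : ℝ} (hs : 0 ≤ s) (hp : 0 ≤ p)
    (hq : 0 ≤ q) (h : Integrable (fun v : ℝ => |v| ^ s) μ) :
    WildIntegrable p q μ fun v : ℝ => |v| ^ s := by
  intro y hy hy1
  set K : ℝ := 2 * (p + q) ^ s with hK
  have hK0 : 0 ≤ K := by positivity
  set P : ℕ → ℝ := fun n => Nat.rec (∫ v, |v| ^ s ∂μ)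
    (fun n x => (1 + K / (n + 1)) * x) n with hPdef
  have hsucc : ∀ n : ℕ, P (n + 1) = (1 + K / (n + 1)) * P n := fun n => rfl
  have hP : ∀ n, 0 ≤ P n := by
    intro n
    induction n with
    | zero => exact integral_nonneg fun v => by positivity
    | succ n ih =>
      rw [hsucc]
      positivity
  have hle := lintegral_wild_rpow_le hs hp hq hP
    (ofReal_integral_eq_lintegral_ofReal h (ae_of_all _ fun v => by positivity)).ge hsucc
  -- The ratios of `P` tend to 1, so any ratio strictly between y and 1 works; the midpoint is
  -- taken.
  have hsum : Summable fun n => y ^ n * P n := by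
    refine summable_of_ratio_norm_eventually_le (r := (1 + y) / 2) (by linarith) ?_
    have hlim : Tendsto (fun n : ℕ => y * (1 + K * (1 / ((n : ℝ) + 1)))) atTop
        (𝓝 (y * (1 + K * 0))) :=
      ((tendsto_one_div_add_atTop_nhds_zero_nat.const_mul K).const_add 1).const_mul y
    filter_upwards [hlim.eventually_le_const (show y * (1 + K * 0) < (1 + y) / 2 by linarith)]
      with n hn
    have h1 := hP n
    rw [Real.norm_of_nonneg (mul_nonneg (pow_nonneg hy (n + 1)) (hP (n + 1))),
      Real.norm_of_nonneg (mul_nonneg (pow_nonneg hy n) h1), hsucc]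
    calc y ^ (n + 1) * ((1 + K / (n + 1)) * P n)
        = (y * (1 + K * (1 / ((n : ℝ) + 1)))) * (y ^ n * P n) := by ring
      _ ≤ _ := by gcongr
  refine ⟨(by fun_prop : Measurable fun v : ℝ => |v| ^ s).aestronglyMeasurable, ?_⟩
  rw [hasFiniteIntegral_iff_ofReal (ae_of_all _ fun v => by positivity), wildSum,
    lintegral_sum_measure]
  calc _ ≤ ∑' n, ENNReal.ofReal (y ^ n * P n) := by
        refine ENNReal.tsum_le_tsum fun n => ?_
        rw [lintegral_smul_measure, smul_eq_mul, ENNReal.ofReal_mul (pow_nonneg hy n)]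
        refine mul_le_mul' (ENNReal.ofReal_le_ofReal ?_) ?_
        · nlinarith [pow_nonneg hy n]
        · exact (Finset.single_le_sum
            (f := fun k => ∫⁻ v, ENNReal.ofReal (|v| ^ s) ∂MaxwellKinetic.wild p q μ k)
            (fun _ _ => zero_le) (Finset.mem_range.2 n.lt_succ_self)).trans (hle n)
    _ < ⊤ := hsum.tsum_ofReal_lt_top

end MaxwellKinetic

end

/-! ### Dilations and the collision operator in weak form -/

noncomputable section

namespace MaxwellKinetic

/-- The law of `a X` when `X` has law `μ`. -/
def dilate (a : ℝ) (μ : ProbabilityMeasure ℝ) : ProbabilityMeasure ℝ :=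
  μ.map (f := fun v => a * v) (measurable_const_mul a).aemeasurable

theorem dilate_coe (a : ℝ) (μ : ProbabilityMeasure ℝ) :
    (dilate a μ : Measure ℝ) = (μ : Measure ℝ).map fun v => a * v := rfl

theorem dilate_one (μ : ProbabilityMeasure ℝ) : dilate 1 μ = μ := by
  apply Subtype.ext
  change (dilate 1 μ : Measure ℝ) = μ
  simp [dilate_coe]

theorem integral_dilate {E : Type*} [NormedAddCommGroup E] [NormedSpace ℝ E] (a : ℝ)
    (μ : ProbabilityMeasure ℝ) {φ : ℝ → E} (hφ : StronglyMeasurable φ) :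
    ∫ v, φ v ∂(dilate a μ : Measure ℝ) = ∫ v, φ (a * v) ∂(μ : Measure ℝ) := by
  rw [dilate_coe, integral_map (by fun_prop) hφ.aestronglyMeasurable]

theorem charFun_dilate (a : ℝ) (μ : ProbabilityMeasure ℝ) (ξ : ℝ) :
    charFun (dilate a μ : Measure ℝ) ξ = charFun (μ : Measure ℝ) (a * ξ) :=
  charFun_map_mul a ξ

/-- A dilation by `a` is the image of δ_a ⊗ μ under multiplication, and products and continuous
images are weakly continuous; this gives joint continuity in the factor and the measure. -/
theorem continuousOn_dilate {a : ℝ → ℝ} {g : ℝ → ProbabilityMeasure ℝ} {S : Set ℝ}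
    (ha : ContinuousOn a S) (hg : ContinuousOn g S) :
    ContinuousOn (fun t => dilate (a t) (g t)) S := by
  have hmul : Continuous fun z : ℝ × ℝ => z.1 * z.2 := by fun_prop
  have h : ∀ t, dilate (a t) (g t) = ((diracProba (a t)).prod (g t)).map
      hmul.measurable.aemeasurable := by
    intro t
    apply Subtype.ext
    change (dilate (a t) (g t) : Measure ℝ) = (((diracProba (a t)).prod (g t)).map
      hmul.measurable.aemeasurable : Measure ℝ)
    rw [ProbabilityMeasure.toMeasure_map, ProbabilityMeasure.toMeasure_prod, dilate_coe]
    simp only [diracProba, ProbabilityMeasure.coe_mk]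
    rw [Measure.dirac_prod, Measure.map_map hmul.measurable (by fun_prop)]
    rfl
  simp only [h]
  exact (ProbabilityMeasure.continuous_map hmul).comp_continuousOn
    (ProbabilityMeasure.continuous_prod.comp_continuousOn
      ((continuous_diracProba.comp_continuousOn ha).prodMk hg))

/-- The collision operator in weak form. -/
def collisionOp (p q : ℝ) (μ : ProbabilityMeasure ℝ) (φ : ℝ → ℝ) : ℝ :=
  ∫ z : ℝ × ℝ, (φ (p * z.1 + q * z.2) - φ z.1) ∂((μ : Measure ℝ).prod (μ : Measure ℝ))

theorem collisionOp_dilate (p q a : ℝ) (μ : ProbabilityMeasure ℝ) {φ : ℝ → ℝ}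
    (hφ : Continuous φ) :
    collisionOp p q (dilate a μ) φ = collisionOp p q μ fun v => φ (a * v) := by
  rw [collisionOp, collisionOp, dilate_coe, Measure.map_prod_map _ _ (by fun_prop) (by fun_prop),
    integral_map (by fun_prop) (by fun_prop)]
  refine integral_congr_ae (ae_of_all _ fun z => ?_)
  simp only [Prod.map_fst, Prod.map_snd]
  congr 2
  ring

theorem integral_collide {E : Type*} [NormedAddCommGroup E] [NormedSpace ℝ E] (p q : ℝ)
    (μ ν : Measure ℝ) {φ : ℝ → E} (hφ : StronglyMeasurable φ) :
    ∫ v, φ v ∂collide p q μ ν = ∫ z : ℝ × ℝ, φ (p * z.1 + q * z.2) ∂μ.prod ν := by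
  rw [collide, integral_map (measurable_collision p q).aemeasurable hφ.aestronglyMeasurable]

theorem collisionOp_eq (p q : ℝ) {μ : ProbabilityMeasure ℝ} {φ : ℝ → ℝ}
    (hm : StronglyMeasurable φ) (h1 : Integrable φ (collide p q μ μ))
    (h2 : Integrable φ (μ : Measure ℝ)) :
    collisionOp p q μ φ = ∫ v, φ v ∂collide p q μ μ - ∫ v, φ v ∂(μ : Measure ℝ) := by
  have h3 : Integrable (fun z : ℝ × ℝ => φ (p * z.1 + q * z.2))
      ((μ : Measure ℝ).prod (μ : Measure ℝ)) := (integrable_map_measure hm.aestronglyMeasurable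
    (measurable_collision p q).aemeasurable).1 h1
  rw [collisionOp, integral_sub h3 (h2.comp_fst _), integral_collide p q _ _ hm, integral_fun_fst]
  simp

theorem collisionOp_eq_of_bounded (p q : ℝ) (μ : ProbabilityMeasure ℝ) {φ : ℝ → ℝ}
    (hm : StronglyMeasurable φ) {C : ℝ} (hC : ∀ v, ‖φ v‖ ≤ C) :
    collisionOp p q μ φ = ∫ v, φ v ∂collide p q μ μ - ∫ v, φ v ∂(μ : Measure ℝ) :=
  collisionOp_eq p q hm (Integrable.of_bound hm.aestronglyMeasurable C (ae_of_all _ hC))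
    (Integrable.of_bound hm.aestronglyMeasurable C (ae_of_all _ hC))

theorem weakOp_eq (p q : ℝ) (μ : ProbabilityMeasure ℝ) (φ : ℝ → ℝ) :
    weakOp p q μ φ = collisionOp p q μ φ -
      (p ^ 2 + q ^ 2 - 1) / 2 * ∫ v, v * deriv φ v ∂(μ : Measure ℝ) := rfl

theorem charFun_collide (p q : ℝ) (μ ν : Measure ℝ) [IsProbabilityMeasure μ]
    [IsProbabilityMeasure ν] (ξ : ℝ) :
    charFun (collide p q μ ν) ξ = charFun μ (p * ξ) * charFun ν (q * ξ) := by
  simp only [charFun_apply_real]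
  rw [integral_collide p q μ ν (by fun_prop), ← integral_prod_mul]
  refine integral_congr_ae (ae_of_all _ fun z => ?_)
  simp only
  rw [← Complex.exp_add]
  congr 1
  push_cast
  ring

theorem continuousOn_integral {g : ℝ → ProbabilityMeasure ℝ} {S : Set ℝ} (hg : ContinuousOn g S)
    {φ : ℝ → ℝ} (hφ : Continuous φ) {C : ℝ} (hC : ∀ v, ‖φ v‖ ≤ C) :
    ContinuousOn (fun t => ∫ v, φ v ∂(g t : Measure ℝ)) S := fun t ht =>
  ProbabilityMeasure.tendsto_iff_forall_integral_tendsto.1 (hg t ht)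
    (BoundedContinuousFunction.ofNormedAddCommGroup φ hφ C hC)

theorem continuousOn_collisionOp (p q : ℝ) {g : ℝ → ProbabilityMeasure ℝ} {S : Set ℝ}
    (hg : ContinuousOn g S) {φ : ℝ → ℝ} (hφ : Continuous φ) {C : ℝ} (hC : ∀ v, ‖φ v‖ ≤ C) :
    ContinuousOn (fun t => collisionOp p q (g t) φ) S := by
  intro t ht
  have h := (ProbabilityMeasure.continuous_prod (α := ℝ) (β := ℝ)).comp_continuousOn
    (hg.prodMk hg)
  refine ProbabilityMeasure.tendsto_iff_forall_integral_tendsto.1 (h t ht)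
    (BoundedContinuousFunction.ofNormedAddCommGroup
      (fun z : ℝ × ℝ => φ (p * z.1 + q * z.2) - φ z.1) (by fun_prop) (C + C) fun z => ?_)
  exact (norm_sub_le _ _).trans (add_le_add (hC _) (hC _))

/-! ### Exchanging drift for dilation -/

/-- Weakly continuous curves of probability measures that solve the collision dynamics without
drift. -/
structure IsCollisionCurve (p q : ℝ) (f : ℝ → ProbabilityMeasure ℝ) : Prop where
  continuousOn : ContinuousOn f (Set.Ici 0)
  weak_eq : ∀ φ : ℝ → ℝ, ContDiff ℝ ∞ φ → HasCompactSupport φ → ∀ t : ℝ, 0 < t →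
    HasDerivAt (fun s => ∫ v, φ v ∂(f s : Measure ℝ)) (collisionOp p q (f t) φ) t

theorem isCollisionCurve_wildCurve (p q : ℝ) (f₀ : ProbabilityMeasure ℝ) :
    IsCollisionCurve p q (wildCurve p q f₀) where
  continuousOn := continuousOn_wildCurve f₀
  weak_eq φ hφ hs t ht := by
    obtain ⟨C, hC⟩ := hs.exists_bound_of_continuous hφ.continuous
    rw [collisionOp_eq_of_bounded p q _ hφ.continuous.stronglyMeasurable hC]
    exact (wildIntegrable_of_bounded hφ.continuous.stronglyMeasurable hC).hasDerivAt ht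

/-- A crude Taylor remainder from two applications of the mean value inequality. It serves to make
difference quotients converge uniformly in the velocity. -/
theorem abs_sub_sub_mul_le {θ ρ ρ' : ℝ → ℝ} {C : ℝ} (h1 : ∀ a, HasDerivAt θ (ρ a) a)
    (h2 : ∀ a, HasDerivAt ρ (ρ' a) a) (hC : ∀ a, ‖ρ' a‖ ≤ C) (s t : ℝ) :
    ‖θ s - θ t - (s - t) * ρ t‖ ≤ C * ‖s - t‖ ^ 2 := by
  have hC0 : 0 ≤ C := (norm_nonneg _).trans (hC 0)
  have hρ : ∀ a, ‖ρ a - ρ t‖ ≤ C * ‖a - t‖ := fun a =>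
    convex_univ.norm_image_sub_le_of_norm_hasDerivWithin_le
      (fun x _ => (h2 x).hasDerivWithinAt) (fun x _ => hC x) (Set.mem_univ t) (Set.mem_univ a)
  have h3 : ∀ a, HasDerivAt (fun a => θ a - a * ρ t) (ρ a - ρ t) a := fun a =>
    ((h1 a).sub ((hasDerivAt_id a).mul_const (ρ t))).congr_deriv (by simp)
  have h4 := (convex_uIcc t s).norm_image_sub_le_of_norm_hasDerivWithin_le (C := C * ‖s - t‖)
    (fun x _ => (h3 x).hasDerivWithinAt) (fun x hx => (hρ x).trans (by
      gcongr
      exact Set.abs_sub_left_of_mem_uIcc hx)) Set.left_mem_uIcc Set.right_mem_uIcc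
  calc _ = ‖θ s - s * ρ t - (θ t - t * ρ t)‖ := by
        congr 1
        ring
    _ ≤ _ := h4
    _ = _ := by ring

/-- The time derivative of an observable under a time dependent dilation. -/
theorem hasDerivAt_integral_dilation {h : ℝ → ProbabilityMeasure ℝ}
    (hc : ContinuousOn h (Set.Ici 0)) {κ t : ℝ} (ht : 0 < t) {φ : ℝ → ℝ}
    (hφ : ContDiff ℝ ∞ φ) (hs : HasCompactSupport φ) {L : ℝ}
    (hL : HasDerivAt (fun s => ∫ v, φ (Real.exp (κ * t) * v) ∂(h s : Measure ℝ)) L t) :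
    HasDerivAt (fun s => ∫ v, φ (Real.exp (κ * s) * v) ∂(h s : Measure ℝ))
      (L + κ * ∫ v, Real.exp (κ * t) * v * deriv φ (Real.exp (κ * t) * v) ∂(h t : Measure ℝ))
      t := by
  -- The generator of dilations applied to `φ`. It is again smooth with compact support, so applying
  -- the generator once more gives a bounded function, which controls the second derivative in time
  -- uniformly in `v`.
  set η : ℝ → ℝ := fun x => x * deriv φ x with hη
  have hηd : ContDiff ℝ ∞ η := contDiff_id.mul (contDiff_infty_iff_deriv.1 hφ).2
  have hηs : HasCompactSupport η := hs.deriv.mul_left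
  obtain ⟨C₁, hC₁⟩ := hηs.exists_bound_of_continuous hηd.continuous
  obtain ⟨C₀, hC₀⟩ := hs.exists_bound_of_continuous hφ.continuous
  have hη2c : Continuous fun x => x * deriv η x :=
    continuous_id.mul (hηd.continuous_deriv (by simp))
  have hη2s : HasCompactSupport fun x => x * deriv η x := hηs.deriv.mul_left
  obtain ⟨C₂, hC₂⟩ := hη2s.exists_bound_of_continuous hη2c
  have hE : ∀ v a : ℝ, HasDerivAt (fun a => Real.exp (κ * a) * v) (κ * (Real.exp (κ * a) * v)) a := by
    intro v a
    have := (((hasDerivAt_id a).const_mul κ).exp).mul_const v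
    refine this.congr_deriv ?_
    simp
    ring
  have htay : ∀ v s : ℝ, ‖φ (Real.exp (κ * s) * v) - φ (Real.exp (κ * t) * v) -
      (s - t) * (κ * η (Real.exp (κ * t) * v))‖ ≤ κ ^ 2 * C₂ * ‖s - t‖ ^ 2 := by
    intro v s
    refine abs_sub_sub_mul_le (θ := fun a => φ (Real.exp (κ * a) * v))
      (ρ := fun a => κ * η (Real.exp (κ * a) * v))
      (ρ' := fun a => κ ^ 2 * ((Real.exp (κ * a) * v) * deriv η (Real.exp (κ * a) * v)))
      ?_ ?_ ?_ s t
    · intro a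
      have := ((hφ.differentiable (by simp)) (Real.exp (κ * a) * v)).hasDerivAt.comp a (hE v a)
      refine this.congr_deriv ?_
      simp only [hη]
      ring
    · intro a
      have := (((hηd.differentiable (by simp)) (Real.exp (κ * a) * v)).hasDerivAt.comp a
        (hE v a)).const_mul κ
      refine this.congr_deriv ?_
      ring
    · intro a
      rw [norm_mul, Real.norm_of_nonneg (sq_nonneg κ)]
      gcongr
      exact hC₂ _
  have hint : ∀ (a s : ℝ), Integrable (fun v => φ (a * v)) (h s : Measure ℝ) := fun a s =>
    Integrable.of_bound (by have := hφ.continuous; fun_prop) C₀ (ae_of_all _ fun v => hC₀ _)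
  have hintη : ∀ (s : ℝ), Integrable (fun v => η (Real.exp (κ * t) * v)) (h s : Measure ℝ) :=
    fun s => Integrable.of_bound (by have := hηd.continuous; fun_prop) C₁
      (ae_of_all _ fun v => hC₁ _)
  -- `hL` accounts for the motion of the measure at a frozen scale; this is the motion of the scale.
  -- Its difference quotient is within O(|s - t|) of κ∫η against `h s`, and weak continuity replaces
  -- `h s` by `h t`.
  have hG : HasDerivAt (fun s => ∫ v, φ (Real.exp (κ * s) * v) ∂(h s : Measure ℝ) -
      ∫ v, φ (Real.exp (κ * t) * v) ∂(h s : Measure ℝ))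
      (κ * ∫ v, η (Real.exp (κ * t) * v) ∂(h t : Measure ℝ)) t := by
    rw [hasDerivAt_iff_tendsto_slope]
    have hlim : Tendsto (fun s => κ * ∫ v, η (Real.exp (κ * t) * v) ∂(h s : Measure ℝ)) (𝓝[≠] t)
        (𝓝 (κ * ∫ v, η (Real.exp (κ * t) * v) ∂(h t : Measure ℝ))) := by
      have h1 := continuousOn_integral hc (φ := fun v => η (Real.exp (κ * t) * v))
        (by have := hηd.continuous; fun_prop) (fun v => hC₁ _)
      have h2 := (h1.continuousAt (Ici_mem_nhds ht)).tendsto.const_mul κ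
      exact h2.mono_left nhdsWithin_le_nhds
    have hz : Tendsto (fun s : ℝ => κ ^ 2 * C₂ * ‖s - t‖) (𝓝[≠] t) (𝓝 0) := by
      have : Tendsto (fun s : ℝ => κ ^ 2 * C₂ * ‖s - t‖) (𝓝 t) (𝓝 (κ ^ 2 * C₂ * ‖t - t‖)) :=
        Continuous.tendsto (by fun_prop) t
      rw [sub_self, norm_zero, mul_zero] at this
      exact this.mono_left nhdsWithin_le_nhds
    refine (tendsto_iff_of_dist ?_).1 hlim
    refine squeeze_zero' (Eventually.of_forall fun _ => dist_nonneg) ?_ hz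
    filter_upwards [self_mem_nhdsWithin] with s hst
    have hst' : s - t ≠ 0 := sub_ne_zero.2 hst
    rw [dist_comm, dist_eq_norm, slope_def_field, sub_self, sub_zero]
    have e : (∫ v, φ (Real.exp (κ * s) * v) ∂(h s : Measure ℝ) -
        ∫ v, φ (Real.exp (κ * t) * v) ∂(h s : Measure ℝ)) / (s - t) -
        κ * ∫ v, η (Real.exp (κ * t) * v) ∂(h s : Measure ℝ) =
        (s - t)⁻¹ * ∫ v, (φ (Real.exp (κ * s) * v) - φ (Real.exp (κ * t) * v) -
          (s - t) * (κ * η (Real.exp (κ * t) * v))) ∂(h s : Measure ℝ) := by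
      have hd : Integrable (fun v => φ (Real.exp (κ * s) * v) - φ (Real.exp (κ * t) * v))
          (h s : Measure ℝ) := (hint _ _).sub (hint _ _)
      rw [integral_sub hd (((hintη s).const_mul κ).const_mul (s - t)),
        integral_sub (hint _ _) (hint _ _), integral_const_mul, integral_const_mul]
      field_simp
    rw [e, norm_mul, norm_inv]
    have hb := norm_integral_le_of_norm_le_const (μ := (h s : Measure ℝ))
      (ae_of_all _ fun v => htay v s)
    rw [probReal_univ, mul_one] at hb
    rw [inv_mul_le_iff₀ (norm_pos_iff.2 hst')]
    refine hb.trans (le_of_eq ?_)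
    ring
  refine (hL.add hG).congr_of_eventuallyEq ?_
  filter_upwards with s
  simp

theorem hasCompactSupport_comp_mul {φ : ℝ → ℝ} (hs : HasCompactSupport φ) {a : ℝ} (ha : a ≠ 0) :
    HasCompactSupport fun v => φ (a * v) :=
  hs.comp_homeomorph (Homeomorph.mulLeft₀ a ha)

/-- Removing the drift by a time dependent dilation. -/
theorem IsWeakSolution.isCollisionCurve {p q : ℝ} {f₀ : ProbabilityMeasure ℝ}
    {g : ℝ → ProbabilityMeasure ℝ} (hg : IsWeakSolution p q f₀ g) :
    IsCollisionCurve p q fun t => dilate (Real.exp ((p ^ 2 + q ^ 2 - 1) / 2 * t)) (g t) where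
  continuousOn := continuousOn_dilate (by fun_prop) hg.continuousOn
  weak_eq φ hφ hs t ht := by
    set κ := (p ^ 2 + q ^ 2 - 1) / 2 with hκ
    have h1 := hg.weak_eq (fun v => φ (Real.exp (κ * t) * v)) (by fun_prop)
      (hasCompactSupport_comp_mul hs (Real.exp_pos _).ne') t ht
    have h2 := hasDerivAt_integral_dilation hg.continuousOn ht hφ hs h1
    simp only [integral_dilate _ _ hφ.continuous.stronglyMeasurable]
    refine h2.congr_deriv ?_
    rw [weakOp_eq, collisionOp_dilate p q _ _ hφ.continuous, ← hκ]
    have e : ∀ v, v * deriv (fun v => φ (Real.exp (κ * t) * v)) v =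
        Real.exp (κ * t) * v * deriv φ (Real.exp (κ * t) * v) := by
      intro v
      rw [deriv_comp_mul_left, smul_eq_mul]
      ring
    simp only [e]
    ring

/-- Adding the drift by a time dependent dilation. -/
theorem IsCollisionCurve.isWeakSolution {p q : ℝ} {f : ℝ → ProbabilityMeasure ℝ}
    (hf : IsCollisionCurve p q f) :
    IsWeakSolution p q (f 0) fun t => dilate (Real.exp (-((p ^ 2 + q ^ 2 - 1) / 2) * t)) (f t) where
  initial := by simp [dilate_one]
  continuousOn := continuousOn_dilate (by fun_prop) hf.continuousOn
  weak_eq φ hφ hs t ht := by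
    set κ := (p ^ 2 + q ^ 2 - 1) / 2 with hκ
    have h1 := hf.weak_eq (fun v => φ (Real.exp (-κ * t) * v)) (by fun_prop)
      (hasCompactSupport_comp_mul hs (Real.exp_pos _).ne') t ht
    have h2 := hasDerivAt_integral_dilation hf.continuousOn ht hφ hs h1
    simp only [integral_dilate _ _ hφ.continuous.stronglyMeasurable]
    refine h2.congr_deriv ?_
    rw [weakOp_eq, collisionOp_dilate p q _ _ hφ.continuous, ← hκ, integral_dilate]
    · ring
    · exact (continuous_id.mul (hφ.continuous_deriv (by simp))).stronglyMeasurable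

/-! ### From the weak form to characteristic functions -/

/-- The weak form extends from compactly supported to bounded smooth observables. -/
theorem IsCollisionCurve.hasDerivAt_of_bounded {p q : ℝ} {f : ℝ → ProbabilityMeasure ℝ}
    (hf : IsCollisionCurve p q f) {φ : ℝ → ℝ} (hφ : ContDiff ℝ ∞ φ) {C : ℝ}
    (hC : ∀ v, ‖φ v‖ ≤ C) {t : ℝ} (ht : 0 < t) :
    HasDerivAt (fun s => ∫ v, φ v ∂(f s : Measure ℝ)) (collisionOp p q (f t) φ) t := by
  have hφc := hφ.continuous
  let χ : ContDiffBump (0 : ℝ) := ⟨1, 2, one_pos, one_lt_two⟩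
  set ψ : ℕ → ℝ → ℝ := fun n v => χ (((n : ℝ) + 1)⁻¹ * v) * φ v with hψ
  have hχc : Continuous χ := χ.continuous
  have hψd : ∀ n, ContDiff ℝ ∞ (ψ n) := fun n =>
    (χ.contDiff.comp (contDiff_const.mul contDiff_id)).mul hφ
  have hψs : ∀ n, HasCompactSupport (ψ n) := fun n =>
    (hasCompactSupport_comp_mul χ.hasCompactSupport (by positivity)).mul_right
  have hψC : ∀ n v, ‖ψ n v‖ ≤ C := fun n v => by
    rw [norm_mul, Real.norm_of_nonneg χ.nonneg]
    calc _ ≤ 1 * ‖φ v‖ := by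
          gcongr
          exact χ.le_one
      _ ≤ C := by rw [one_mul]; exact hC v
  have hlim : ∀ v, Tendsto (fun n => ψ n v) atTop (𝓝 (φ v)) := by
    intro v
    refine tendsto_const_nhds.congr' ?_
    obtain ⟨N, hN⟩ := exists_nat_ge |v|
    filter_upwards [eventually_ge_atTop N] with n hn
    have h1 : χ (((n : ℝ) + 1)⁻¹ * v) = 1 := by
      refine χ.one_of_mem_closedBall ?_
      rw [mem_closedBall_zero_iff, Real.norm_eq_abs, abs_mul, abs_of_pos (by positivity),
        inv_mul_le_iff₀ (by positivity)]
      have : (N : ℝ) ≤ n := by exact_mod_cast hn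
      change |v| ≤ (n + 1) * 1
      linarith
    simp [hψ, h1]
  have hopC : ∀ s, ∀ n, ‖collisionOp p q (f s) (ψ n)‖ ≤ C + C := by
    intro s n
    have := norm_integral_le_of_norm_le_const
      (μ := (f s : Measure ℝ).prod (f s : Measure ℝ))
      (f := fun z : ℝ × ℝ => ψ n (p * z.1 + q * z.2) - ψ n z.1) (C := C + C)
      (ae_of_all _ fun z => (norm_sub_le _ _).trans (add_le_add (hψC _ _) (hψC _ _)))
    simpa [collisionOp] using this
  have hoplim : ∀ s, Tendsto (fun n => collisionOp p q (f s) (ψ n)) atTop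
      (𝓝 (collisionOp p q (f s) φ)) := by
    intro s
    refine tendsto_integral_of_dominated_convergence (fun _ => C + C) (fun n => ?_)
      (integrable_const _) (fun n => ae_of_all _ fun z =>
        (norm_sub_le _ _).trans (add_le_add (hψC _ _) (hψC _ _)))
      (ae_of_all _ fun z => (hlim _).sub (hlim _))
    have := (hψd n).continuous
    fun_prop
  have hintlim : ∀ s, Tendsto (fun n => ∫ v, ψ n v ∂(f s : Measure ℝ)) atTop
      (𝓝 (∫ v, φ v ∂(f s : Measure ℝ))) := fun s =>
    tendsto_integral_of_dominated_convergence (fun _ => C)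
      (fun n => (hψd n).continuous.aestronglyMeasurable) (integrable_const _)
      (fun n => ae_of_all _ fun z => hψC _ _) (ae_of_all _ fun z => hlim _)
  have hψop : ∀ n, ContinuousOn (fun s => collisionOp p q (f s) (ψ n)) (Set.Ici 0) := fun n =>
    continuousOn_collisionOp p q hf.continuousOn (hψd n).continuous (hψC n)
  have hop : ContinuousOn (fun s => collisionOp p q (f s) φ) (Set.Ici 0) :=
    continuousOn_collisionOp p q hf.continuousOn hφc hC
  have hsub : ∀ {s : ℝ}, 0 ≤ s → Set.uIcc 0 s ⊆ Set.Ici 0 := fun {s} hs => by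
    rw [Set.uIcc_of_le hs]
    exact Set.Icc_subset_Ici_self
  -- Pointwise limits do not pass through derivatives, so the cutoff is removed in the
  -- time-integrated identity by dominated convergence, which is then differentiated again.
  have hFTC : ∀ n s, 0 ≤ s → ∫ τ in (0 : ℝ)..s, collisionOp p q (f τ) (ψ n) =
      ∫ v, ψ n v ∂(f s : Measure ℝ) - ∫ v, ψ n v ∂(f 0 : Measure ℝ) := by
    intro n s hs
    refine intervalIntegral.integral_eq_sub_of_hasDerivAt_of_le hs
      ((continuousOn_integral hf.continuousOn (hψd n).continuous (hψC n)).mono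
        Set.Icc_subset_Ici_self) (fun x hx => hf.weak_eq _ (hψd n) (hψs n) x hx.1)
      ((hψop n).mono (hsub hs)).intervalIntegrable
  have hFTC' : ∀ s, 0 ≤ s → ∫ v, φ v ∂(f s : Measure ℝ) =
      ∫ v, φ v ∂(f 0 : Measure ℝ) + ∫ τ in (0 : ℝ)..s, collisionOp p q (f τ) φ := by
    intro s hs
    have h1 : Tendsto (fun n => ∫ τ in (0 : ℝ)..s, collisionOp p q (f τ) (ψ n)) atTop
        (𝓝 (∫ τ in (0 : ℝ)..s, collisionOp p q (f τ) φ)) := by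
      refine intervalIntegral.tendsto_integral_filter_of_dominated_convergence (fun _ => C + C)
        (Eventually.of_forall fun n => ?_) (Eventually.of_forall fun n => ae_of_all _ fun x _ =>
          hopC x n) intervalIntegrable_const (ae_of_all _ fun x _ => hoplim x)
      exact ((hψop n).mono (Set.uIoc_subset_uIcc.trans (hsub hs))).aestronglyMeasurable
        measurableSet_uIoc
    simp only [hFTC _ s hs] at h1
    have h2 := tendsto_nhds_unique h1 ((hintlim s).sub (hintlim 0))
    rw [h2]
    ring
  have hd : HasDerivAt (fun s => ∫ v, φ v ∂(f 0 : Measure ℝ) +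
      ∫ τ in (0 : ℝ)..s, collisionOp p q (f τ) φ) (collisionOp p q (f t) φ) t := by
    refine (intervalIntegral.integral_hasDerivAt_right
      ((hop.mono (hsub ht.le)).intervalIntegrable) ?_
      (hop.continuousAt (Ici_mem_nhds ht))).const_add _
    exact (hop.mono Set.Ioi_subset_Ici_self).stronglyMeasurableAtFilter isOpen_Ioi t ht
  refine hd.congr_of_eventuallyEq ?_
  filter_upwards [eventually_ge_nhds ht] with s hs
  exact hFTC' s hs

/-- The weak form is stated for real observables, so the complex exponential is tested through its
two real parts. -/
theorem charFun_eq_integral_cos_add (μ : Measure ℝ) [IsProbabilityMeasure μ] (ξ : ℝ) :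
    charFun μ ξ = ((∫ v, Real.cos (ξ * v) ∂μ : ℝ) : ℂ) +
      ((∫ v, Real.sin (ξ * v) ∂μ : ℝ) : ℂ) * Complex.I := by
  have hc : Integrable (fun v => (Real.cos (ξ * v) : ℂ)) μ :=
    Integrable.of_bound (by fun_prop) 1 (ae_of_all _ fun v => by
      rw [Complex.norm_real]; exact Real.abs_cos_le_one _)
  have hs : Integrable (fun v => (Real.sin (ξ * v) : ℂ)) μ :=
    Integrable.of_bound (by fun_prop) 1 (ae_of_all _ fun v => by
      rw [Complex.norm_real]; exact Real.abs_sin_le_one _)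
  rw [charFun_apply_real, ← integral_complex_ofReal, ← integral_complex_ofReal,
    ← integral_mul_const, ← integral_add hc (hs.mul_const _)]
  refine integral_congr_ae (ae_of_all _ fun v => ?_)
  simp only
  rw [Complex.exp_mul_I, Complex.ofReal_cos, Complex.ofReal_sin]
  push_cast
  rfl

theorem IsCollisionCurve.isFourierSolution {p q : ℝ} {f : ℝ → ProbabilityMeasure ℝ}
    (hf : IsCollisionCurve p q f) :
    IsFourierSolution p q fun t ξ => charFun (f t : Measure ℝ) ξ where
  norm_le_one t ξ _ := norm_charFun_le_one ξ
  continuousOn ξ := by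
    simp only [charFun_eq_integral_cos_add]
    have hc := continuousOn_integral hf.continuousOn (φ := fun v => Real.cos (ξ * v))
      (by fun_prop) (fun v => Real.abs_cos_le_one _)
    have hs := continuousOn_integral hf.continuousOn (φ := fun v => Real.sin (ξ * v))
      (by fun_prop) (fun v => Real.abs_sin_le_one _)
    exact (Complex.continuous_ofReal.comp_continuousOn hc).add
      ((Complex.continuous_ofReal.comp_continuousOn hs).mul continuousOn_const)
  hasDerivAt ξ t ht := by
    rw [← charFun_collide]
    simp only [charFun_eq_integral_cos_add]
    have hc := hf.hasDerivAt_of_bounded (φ := fun v => Real.cos (ξ * v))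
      (by fun_prop) (fun v => Real.abs_cos_le_one _) ht
    have hs := hf.hasDerivAt_of_bounded (φ := fun v => Real.sin (ξ * v))
      (by fun_prop) (fun v => Real.abs_sin_le_one _) ht
    rw [collisionOp_eq_of_bounded p q _ (by fun_prop) (fun v => Real.abs_cos_le_one _)] at hc
    rw [collisionOp_eq_of_bounded p q _ (by fun_prop) (fun v => Real.abs_sin_le_one _)] at hs
    refine (hc.ofReal_comp.add (hs.ofReal_comp.mul_const Complex.I)).congr_deriv ?_
    push_cast
    ring

end MaxwellKinetic

end

/-! ### Contraction and uniqueness of weak solutions -/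

noncomputable section

namespace MaxwellKinetic

variable {p q : ℝ}

theorem IsWeakSolution.shift {f₀ : ProbabilityMeasure ℝ} {g : ℝ → ProbabilityMeasure ℝ}
    (hg : IsWeakSolution p q f₀ g) {h : ℝ} (hh : 0 ≤ h) :
    IsWeakSolution p q (g h) fun t => g (t + h) where
  initial := by simp
  continuousOn := hg.continuousOn.comp (by fun_prop) fun t ht => by
    simp only [Set.mem_Ici] at *
    linarith
  weak_eq φ hφ hs t ht := (hg.weak_eq φ hφ hs (t + h) (by linarith)).comp_add_const t h

theorem IsStationary.isWeakSolution {μ : ProbabilityMeasure ℝ} (hμ : IsStationary p q μ) :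
    IsWeakSolution p q μ fun _ => μ where
  initial := rfl
  continuousOn := continuousOn_const
  weak_eq φ hφ hs t _ := by
    rw [hμ φ hφ hs]
    exact hasDerivAt_const t _

theorem IsWeakSolution.isFourierSolution {f₀ : ProbabilityMeasure ℝ}
    {g : ℝ → ProbabilityMeasure ℝ} (hg : IsWeakSolution p q f₀ g) :
    IsFourierSolution p q fun t ξ =>
      charFun (g t : Measure ℝ) (Real.exp ((p ^ 2 + q ^ 2 - 1) / 2 * t) * ξ) := by
  have h := hg.isCollisionCurve.isFourierSolution
  simpa only [charFun_dilate] using h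

/-- The flow does not expand the Fourier metric of order two, and it contracts the metric of order
`2 + δ` at the rate `-keyFun p q δ`. -/
theorem IsWeakSolution.norm_charFun_sub_le (hp : 0 < p) (hq : 0 < q)
    {f₀ f₁ : ProbabilityMeasure ℝ} {g₀ g₁ : ℝ → ProbabilityMeasure ℝ}
    (h₀ : IsWeakSolution p q f₀ g₀) (h₁ : IsWeakSolution p q f₁ g₁) {a b δ : ℝ} (ha : 0 ≤ a)
    (hb : 0 ≤ b) (h : ∀ ξ : ℝ, ‖charFun (f₀ : Measure ℝ) ξ - charFun (f₁ : Measure ℝ) ξ‖ ≤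
      a * |ξ| ^ (2 : ℝ) + b * |ξ| ^ (2 + δ)) {t : ℝ} (ht : 0 ≤ t) (ξ : ℝ) :
    ‖charFun (g₀ t : Measure ℝ) ξ - charFun (g₁ t : Measure ℝ) ξ‖ ≤
      a * |ξ| ^ (2 : ℝ) + b * |ξ| ^ (2 + δ) * Real.exp (keyFun p q δ * t) := by
  set κ := (p ^ 2 + q ^ 2 - 1) / 2 with hκ
  -- Evaluating at e^{-κt}ξ undoes the dilation.
  have h2 := h₀.isFourierSolution.norm_sub_le_rpow hp hq h₁.isFourierSolution ha hb
    (s := 2 + δ) (by simpa [h₀.initial, h₁.initial] using h) ht (Real.exp (-(κ * t)) * ξ)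
  have e1 : Real.exp (κ * t) * (Real.exp (-(κ * t)) * ξ) = ξ := by
    rw [← mul_assoc, ← Real.exp_add, add_neg_cancel, Real.exp_zero, one_mul]
  rw [← hκ, e1] at h2
  refine h2.trans (le_of_eq ?_)
  have e2 : ∀ r : ℝ, |Real.exp (-(κ * t)) * ξ| ^ r = |ξ| ^ r * Real.exp (-(κ * t) * r) := by
    intro r
    rw [abs_mul, Real.abs_exp, Real.mul_rpow (Real.exp_pos _).le (abs_nonneg _), Real.exp_mul]
    ring
  have e3 : Real.exp (-(κ * t) * 2) * Real.exp ((p ^ (2 : ℝ) + q ^ (2 : ℝ) - 1) * t) = 1 := by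
    rw [← Real.exp_add, Real.exp_eq_one_iff, Real.rpow_two, Real.rpow_two, hκ]
    ring
  have e4 : Real.exp (-(κ * t) * (2 + δ)) * Real.exp ((p ^ (2 + δ) + q ^ (2 + δ) - 1) * t) =
      Real.exp (keyFun p q δ * t) := by
    rw [← Real.exp_add, keyFun, hκ]
    ring_nf
  rw [e2, e2]
  linear_combination a * |ξ| ^ (2 : ℝ) * e3 + b * |ξ| ^ (2 + δ) * e4

theorem ext_of_charFun {μ ν : ProbabilityMeasure ℝ}
    (h : ∀ ξ, charFun (μ : Measure ℝ) ξ = charFun (ν : Measure ℝ) ξ) : μ = ν :=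
  Subtype.ext (Measure.ext_of_charFun (μ := (μ : Measure ℝ)) (ν := (ν : Measure ℝ)) (funext h))

theorem IsWeakSolution.unique (hp : 0 < p) (hq : 0 < q) {f₀ : ProbabilityMeasure ℝ}
    {g₀ g₁ : ℝ → ProbabilityMeasure ℝ} (h₀ : IsWeakSolution p q f₀ g₀)
    (h₁ : IsWeakSolution p q f₀ g₁) {t : ℝ} (ht : 0 ≤ t) : g₀ t = g₁ t := by
  refine ext_of_charFun fun ξ => sub_eq_zero.1 (norm_le_zero_iff.1 ?_)
  have := h₀.norm_charFun_sub_le hp hq h₁ (a := 0) (b := 0) (δ := 0) le_rfl le_rfl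
    (fun ξ => by simp) ht ξ
  simpa using this

/-- The weak solution of the rescaled equation given by the Wild expansion. -/
def rescaledSolution (p q : ℝ) (f₀ : ProbabilityMeasure ℝ) (t : ℝ) : ProbabilityMeasure ℝ :=
  dilate (Real.exp (-((p ^ 2 + q ^ 2 - 1) / 2) * t)) (wildCurve p q f₀ t)

theorem isWeakSolution_rescaledSolution (p q : ℝ) (f₀ : ProbabilityMeasure ℝ) :
    IsWeakSolution p q f₀ (rescaledSolution p q f₀) := by
  have h := (isCollisionCurve_wildCurve p q f₀).isWeakSolution
  rwa [wildCurve_zero] at h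

/-! ### Differential inequalities and moments after one collision -/

theorem eq_mul_exp_of_hasDerivAt {x : ℝ → ℝ} {k : ℝ} (hc : ContinuousOn x (Set.Ici 0))
    (hd : ∀ t, 0 < t → HasDerivAt x (k * x t) t) {t : ℝ} (ht : 0 ≤ t) :
    x t = x 0 * Real.exp (k * t) := by
  have hE : ∀ t : ℝ, HasDerivAt (fun t : ℝ => Real.exp (-k * t)) (Real.exp (-k * t) * -k) t := by
    intro t
    simpa using ((hasDerivAt_id t).const_mul (-k)).exp
  have hw : ∀ t, 0 < t → HasDerivAt (fun t => x t * Real.exp (-k * t)) 0 t := fun t ht =>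
    ((hd t ht).mul (hE t)).congr_deriv (by ring)
  have hwc : ContinuousOn (fun t => x t * Real.exp (-k * t)) (Set.Ici 0) := hc.mul (by fun_prop)
  have h1 := le_of_hasDerivAt_nonneg hwc hw (fun _ _ => le_rfl) ht
  have h2 := le_of_hasDerivAt_nonneg hwc.neg (fun t ht => (hw t ht).neg) (fun _ _ => by simp) ht
  simp only [mul_zero, Real.exp_zero, mul_one, Pi.neg_apply] at h1 h2
  have h3 : x t * Real.exp (-k * t) = x 0 := by linarith
  rw [← h3, mul_assoc, ← Real.exp_add]
  simp

/-- Grönwall in the form that (C/k - x)e^{kt} is nondecreasing. -/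
theorem le_add_div_of_hasDerivAt {x x' : ℝ → ℝ} {k C : ℝ} (hk : 0 < k) (hC : 0 ≤ C)
    (h0 : 0 ≤ x 0) (hc : ContinuousOn x (Set.Ici 0)) (hd : ∀ t, 0 < t → HasDerivAt x (x' t) t)
    (hle : ∀ t, 0 < t → x' t ≤ -k * x t + C) {t : ℝ} (ht : 0 ≤ t) : x t ≤ x 0 + C / k := by
  have hE : ∀ t : ℝ, HasDerivAt (fun t : ℝ => Real.exp (k * t)) (Real.exp (k * t) * k) t := by
    intro t
    simpa using ((hasDerivAt_id t).const_mul k).exp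
  have h := le_of_hasDerivAt_nonneg (w := fun t => (C / k - x t) * Real.exp (k * t))
    ((continuousOn_const.sub hc).mul (by fun_prop))
    (fun t ht => ((hd t ht).const_sub (C / k)).mul (hE t)) (fun t ht => by
      have h1 : -x' t * Real.exp (k * t) + (C / k - x t) * (Real.exp (k * t) * k) =
          Real.exp (k * t) * (-k * x t + C - x' t) := by
        field_simp
        ring
      rw [h1]
      exact mul_nonneg (Real.exp_pos _).le (sub_nonneg.2 (hle t ht))) ht
  simp only [mul_zero, Real.exp_zero, mul_one] at h
  by_contra! hcon
  have h1 : 1 ≤ Real.exp (k * t) := Real.one_le_exp (by positivity)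
  have h2 : C / k - x t < 0 := by linarith
  have h3 : 0 ≤ C / k := by positivity
  nlinarith

theorem integrable_abs_rpow_of_le {μ : Measure ℝ} [IsFiniteMeasure μ] {r s : ℝ} (hr : 0 ≤ r)
    (hrs : r ≤ s) (h : Integrable (fun v : ℝ => |v| ^ s) μ) :
    Integrable (fun v : ℝ => |v| ^ r) μ := by
  refine ((integrable_const 1).add h).mono'
    (by fun_prop : Measurable fun v : ℝ => |v| ^ r).aestronglyMeasurable (ae_of_all _ fun v => ?_)
  rw [Real.norm_of_nonneg (by positivity)]
  change _ ≤ 1 + |v| ^ s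
  have h0 : 0 ≤ |v| ^ s := by positivity
  rcases le_total |v| 1 with hv | hv
  · have := Real.rpow_le_one (abs_nonneg v) hv hr
    linarith
  · have := Real.rpow_le_rpow_of_exponent_le hv hrs
    linarith

theorem integrable_id_of_sq {μ : Measure ℝ} [IsFiniteMeasure μ]
    (h : Integrable (fun v : ℝ => v ^ 2) μ) : Integrable (fun v : ℝ => v) μ := by
  refine ((integrable_const 1).add h).mono' (by fun_prop) (ae_of_all _ fun v => ?_)
  rw [Real.norm_eq_abs]
  change |v| ≤ 1 + v ^ 2
  nlinarith [sq_abs v, sq_nonneg (|v| - 1)]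

theorem integrable_sq_of_rpow {μ : Measure ℝ} [IsFiniteMeasure μ] {s : ℝ} (hs : 2 ≤ s)
    (h : Integrable (fun v : ℝ => |v| ^ s) μ) : Integrable (fun v : ℝ => v ^ 2) μ := by
  have := integrable_abs_rpow_of_le (by norm_num) hs h
  simpa only [Real.rpow_two, sq_abs] using this

theorem integral_collide_id {μ : Measure ℝ} [IsProbabilityMeasure μ]
    (h : Integrable (fun v : ℝ => v) μ) :
    ∫ v, v ∂collide p q μ μ = (p + q) * ∫ v, v ∂μ := by
  rw [integral_collide p q μ μ (by fun_prop), integral_add ((h.comp_fst μ).const_mul p)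
    ((h.comp_snd μ).const_mul q), integral_const_mul, integral_const_mul,
    integral_fun_fst (fun v : ℝ => v), integral_fun_snd (fun v : ℝ => v)]
  simp
  ring

theorem integral_collide_sq {μ : Measure ℝ} [IsProbabilityMeasure μ]
    (h : Integrable (fun v : ℝ => v ^ 2) μ) (h0 : ∫ v, v ∂μ = 0) :
    ∫ v, v ^ 2 ∂collide p q μ μ = (p ^ 2 + q ^ 2) * ∫ v, v ^ 2 ∂μ := by
  have h1 := integrable_id_of_sq h
  rw [integral_collide p q μ μ (by fun_prop)]
  have e : ∀ z : ℝ × ℝ, (p * z.1 + q * z.2) ^ 2 =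
      p ^ 2 * z.1 ^ 2 + q ^ 2 * z.2 ^ 2 + 2 * p * q * (z.1 * z.2) := fun z => by ring
  simp only [e]
  have i1 : Integrable (fun z : ℝ × ℝ => p ^ 2 * z.1 ^ 2) (μ.prod μ) :=
    (h.comp_fst μ).const_mul (p ^ 2)
  have i2 : Integrable (fun z : ℝ × ℝ => q ^ 2 * z.2 ^ 2) (μ.prod μ) :=
    (h.comp_snd μ).const_mul (q ^ 2)
  have i3 : Integrable (fun z : ℝ × ℝ => 2 * p * q * (z.1 * z.2)) (μ.prod μ) :=
    (h1.mul_prod h1).const_mul _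
  rw [integral_add (i1.fun_add i2) i3, integral_add i1 i2, integral_const_mul, integral_const_mul,
    integral_const_mul, integral_fun_fst (fun v : ℝ => v ^ 2),
    integral_fun_snd (fun v : ℝ => v ^ 2), integral_prod_mul (fun v : ℝ => v) (fun v : ℝ => v), h0]
  simp
  ring

theorem IsNormalized.integral_abs_rpow_le_one {μ : ProbabilityMeasure ℝ} (hμ : IsNormalized μ)
    {r : ℝ} (hr : 0 ≤ r) (hr2 : r ≤ 2) : ∫ v, |v| ^ r ∂(μ : Measure ℝ) ≤ 1 := by
  have hsq := hμ.integrable_sq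
  have h1 : ∀ v : ℝ, |v| ^ r ≤ r / 2 * v ^ 2 + (1 - r / 2) := by
    intro v
    have h := Real.geom_mean_le_arith_mean2_weighted (w₁ := r / 2) (w₂ := 1 - r / 2)
      (p₁ := |v| ^ (2 : ℝ)) (p₂ := 1) (by linarith) (by linarith) (by positivity) zero_le_one
      (by ring)
    rw [← Real.rpow_mul (abs_nonneg v), Real.one_rpow, mul_one, mul_one, Real.rpow_two,
      sq_abs] at h
    rwa [mul_div_cancel₀ _ (two_ne_zero : (2 : ℝ) ≠ 0)] at h
  have h2 : Integrable (fun v : ℝ => |v| ^ r) (μ : Measure ℝ) :=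
    integrable_abs_rpow_of_le hr hr2 (by simpa only [Real.rpow_two, sq_abs] using hsq)
  calc ∫ v, |v| ^ r ∂(μ : Measure ℝ) ≤ ∫ v, (r / 2 * v ^ 2 + (1 - r / 2)) ∂(μ : Measure ℝ) :=
        integral_mono h2 ((hsq.const_mul _).add (integrable_const _)) h1
    _ = 1 := by
        rw [integral_add (hsq.const_mul _) (integrable_const _), integral_const_mul, hμ.energy]
        simp

theorem abs_rpow_two_add {δ : ℝ} (hδ : 0 < δ) (x : ℝ) : |x| ^ (2 + δ) = x ^ 2 * |x| ^ δ := by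
  rw [Real.rpow_add' (abs_nonneg x) (by linarith), Real.rpow_two, sq_abs]

/-- Subadditivity of r ↦ r^δ, multiplied by (x+y)² and expanded. The terms that are linear in one
variable keep their sign, so that centering can annihilate them. -/
theorem abs_add_rpow_two_add_le {δ : ℝ} (hδ : 0 < δ) (hδ1 : δ ≤ 1) (x y : ℝ) :
    |x + y| ^ (2 + δ) ≤ |x| ^ (2 + δ) + |y| ^ (2 + δ) + 2 * (x * |x| ^ δ * y) +
      2 * (x * (y * |y| ^ δ)) + x ^ 2 * |y| ^ δ + |x| ^ δ * y ^ 2 := by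
  rw [abs_rpow_two_add hδ, abs_rpow_two_add hδ, abs_rpow_two_add hδ]
  have h1 : |x + y| ^ δ ≤ |x| ^ δ + |y| ^ δ :=
    (Real.rpow_le_rpow (abs_nonneg _) (abs_add_le x y) hδ.le).trans
      (Real.rpow_add_le_add_rpow (abs_nonneg _) (abs_nonneg _) hδ.le hδ1)
  have h2 := mul_le_mul_of_nonneg_left h1 (sq_nonneg (x + y))
  refine h2.trans (le_of_eq ?_)
  ring

/-- Zero mean removes the two signed cross terms; the other mixed terms factor into the energy,
which is 1, and ∫|v|^δ ≤ 1. No part of the top moment is spent, which is why the rate is the full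
|Σ(δ)| for δ ≤ 1. -/
theorem IsNormalized.integral_collide_rpow_le_of_le_one (hp : 0 < p) (hq : 0 < q)
    {μ : ProbabilityMeasure ℝ} (hμ : IsNormalized μ) {δ : ℝ} (hδ : 0 < δ) (hδ1 : δ ≤ 1)
    (h : HasFiniteMoment (2 + δ) μ) :
    ∫ v, |v| ^ (2 + δ) ∂collide p q μ μ ≤ (p ^ (2 + δ) + q ^ (2 + δ)) * absMoment (2 + δ) μ +
      (p ^ 2 * q ^ δ + q ^ 2 * p ^ δ) := by
  have hsq := hμ.integrable_sq
  have hid := integrable_id_of_sq hsq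
  have hδi : Integrable (fun v : ℝ => |v| ^ δ) (μ : Measure ℝ) :=
    integrable_abs_rpow_of_le hδ.le (by linarith) h
  have hδ1i : Integrable (fun v : ℝ => v * |v| ^ δ) (μ : Measure ℝ) := by
    have := integrable_abs_rpow_of_le (r := 1 + δ) (by linarith) (by linarith) h
    refine this.mono' (by fun_prop) (ae_of_all _ fun v => ?_)
    rw [Real.rpow_add' (abs_nonneg v) (by linarith), Real.rpow_one, norm_mul,
      Real.norm_of_nonneg (Real.rpow_nonneg (abs_nonneg v) δ), Real.norm_eq_abs]
  have hle := hμ.integral_abs_rpow_le_one hδ.le (by linarith)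
  have hpd : 0 < p ^ δ := by positivity
  have hqd : 0 < q ^ δ := by positivity
  set ν : Measure ℝ := (μ : Measure ℝ) with hν
  have i1 : Integrable (fun z : ℝ × ℝ => p ^ (2 + δ) * |z.1| ^ (2 + δ)) (ν.prod ν) :=
    (Integrable.comp_fst (f := fun v : ℝ => |v| ^ (2 + δ)) h ν).const_mul _
  have i2 : Integrable (fun z : ℝ × ℝ => q ^ (2 + δ) * |z.2| ^ (2 + δ)) (ν.prod ν) :=
    (Integrable.comp_snd (f := fun v : ℝ => |v| ^ (2 + δ)) h ν).const_mul _
  have i3 : Integrable (fun z : ℝ × ℝ => 2 * p * p ^ δ * q * (z.1 * |z.1| ^ δ * z.2))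
      (ν.prod ν) := (hδ1i.mul_prod hid).const_mul _
  have i4 : Integrable (fun z : ℝ × ℝ => 2 * p * q * q ^ δ * (z.1 * (z.2 * |z.2| ^ δ)))
      (ν.prod ν) := (hid.mul_prod hδ1i).const_mul _
  have i5 : Integrable (fun z : ℝ × ℝ => p ^ 2 * q ^ δ * (z.1 ^ 2 * |z.2| ^ δ)) (ν.prod ν) :=
    (hsq.mul_prod hδi).const_mul _
  have i6 : Integrable (fun z : ℝ × ℝ => q ^ 2 * p ^ δ * (|z.1| ^ δ * z.2 ^ 2)) (ν.prod ν) :=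
    (hδi.mul_prod hsq).const_mul _
  rw [integral_collide p q ν ν (by fun_prop : Measurable fun v : ℝ => |v| ^ (2 + δ)).stronglyMeasurable]
  calc ∫ z : ℝ × ℝ, |p * z.1 + q * z.2| ^ (2 + δ) ∂ν.prod ν
      ≤ ∫ z : ℝ × ℝ, (p ^ (2 + δ) * |z.1| ^ (2 + δ) + q ^ (2 + δ) * |z.2| ^ (2 + δ) +
          2 * p * p ^ δ * q * (z.1 * |z.1| ^ δ * z.2) +
          2 * p * q * q ^ δ * (z.1 * (z.2 * |z.2| ^ δ)) +
          p ^ 2 * q ^ δ * (z.1 ^ 2 * |z.2| ^ δ) +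
          q ^ 2 * p ^ δ * (|z.1| ^ δ * z.2 ^ 2)) ∂ν.prod ν := by
        refine integral_mono_of_nonneg (ae_of_all _ fun z => by positivity)
          (((((i1.fun_add i2).fun_add i3).fun_add i4).fun_add i5).add i6) (ae_of_all _ fun z => ?_)
        refine (abs_add_rpow_two_add_le hδ hδ1 (p * z.1) (q * z.2)).trans (le_of_eq ?_)
        simp only [abs_mul, abs_of_pos hp, abs_of_pos hq, Real.mul_rpow hp.le (abs_nonneg z.1),
          Real.mul_rpow hq.le (abs_nonneg z.2)]
        ring
    _ = (p ^ (2 + δ) + q ^ (2 + δ)) * absMoment (2 + δ) μ +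
          (p ^ 2 * q ^ δ + q ^ 2 * p ^ δ) * ∫ v, |v| ^ δ ∂ν := by
        rw [integral_add ((((i1.fun_add i2).fun_add i3).fun_add i4).fun_add i5) i6,
          integral_add (((i1.fun_add i2).fun_add i3).fun_add i4) i5,
          integral_add ((i1.fun_add i2).fun_add i3) i4, integral_add (i1.fun_add i2) i3, integral_add i1 i2]
        simp only [integral_const_mul]
        rw [integral_fun_fst (fun v : ℝ => |v| ^ (2 + δ)),
          integral_fun_snd (fun v : ℝ => |v| ^ (2 + δ)),
          integral_prod_mul (fun v : ℝ => v * |v| ^ δ) (fun v : ℝ => v),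
          integral_prod_mul (fun v : ℝ => v) (fun v : ℝ => v * |v| ^ δ),
          integral_prod_mul (fun v : ℝ => v ^ 2) (fun v : ℝ => |v| ^ δ),
          integral_prod_mul (fun v : ℝ => |v| ^ δ) (fun v : ℝ => v ^ 2), hμ.mean, hμ.energy,
          absMoment, ← hν]
        simp
        ring
    _ ≤ _ := by
        have : 0 ≤ p ^ 2 * q ^ δ + q ^ 2 * p ^ δ := by positivity
        nlinarith

theorem abs_rpow_sub_one_le {s ε : ℝ} (hs : 1 ≤ s) (hε : 0 < ε) (v : ℝ) :
    |v| ^ (s - 1) ≤ ε * |v| ^ s + ε⁻¹ ^ (s - 1) := by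
  have h0 : 0 ≤ ε * |v| ^ s := by positivity
  have h1 : 0 ≤ ε⁻¹ ^ (s - 1) := by positivity
  rcases le_total |v| ε⁻¹ with hv | hv
  · have := Real.rpow_le_rpow (abs_nonneg v) hv (by linarith : 0 ≤ s - 1)
    linarith
  · have hv0 : 0 < |v| := (inv_pos.2 hε).trans_le hv
    have h2 : |v| ^ s = |v| ^ (s - 1) * |v| := by
      rw [← Real.rpow_add_one hv0.ne']
      ring_nf
    have h3 : 1 ≤ ε * |v| := by
      rwa [inv_le_iff_one_le_mul₀' hε] at hv
    have h4 : 0 ≤ |v| ^ (s - 1) := by positivity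
    rw [h2]
    nlinarith

/-- For higher orders the mixed terms involve the moment of order s - 1, which is absorbed into an
arbitrarily small multiple of the moment of order s. -/
theorem IsNormalized.integral_collide_rpow_le (hp : 0 < p) (hq : 0 < q)
    {μ : ProbabilityMeasure ℝ} (hμ : IsNormalized μ) {s : ℝ} (hs : 2 ≤ s)
    (h : HasFiniteMoment s μ) {ε : ℝ} (hε : 0 < ε) :
    ∫ v, |v| ^ s ∂collide p q μ μ ≤ (p ^ s + q ^ s) * absMoment s μ +
      s * 2 ^ s * (p ^ (s - 1) * q + q ^ (s - 1) * p) *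
        (ε * absMoment s μ + ε⁻¹ ^ (s - 1)) := by
  have hsq := hμ.integrable_sq
  have hid := (integrable_id_of_sq hsq).abs
  have hs1 : Integrable (fun v : ℝ => |v| ^ (s - 1)) (μ : Measure ℝ) :=
    integrable_abs_rpow_of_le (by linarith) (by linarith) h
  have hle : ∫ v, |v| ∂(μ : Measure ℝ) ≤ 1 := by
    simpa using hμ.integral_abs_rpow_le_one zero_le_one one_le_two
  have hle0 : 0 ≤ ∫ v, |v| ∂(μ : Measure ℝ) := integral_nonneg fun v => abs_nonneg v
  have hle1 : ∫ v, |v| ^ (s - 1) ∂(μ : Measure ℝ) ≤ ε * absMoment s μ + ε⁻¹ ^ (s - 1) := by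
    calc _ ≤ ∫ v, (ε * |v| ^ s + ε⁻¹ ^ (s - 1)) ∂(μ : Measure ℝ) :=
          integral_mono hs1 ((h.const_mul ε).add (integrable_const _))
            (abs_rpow_sub_one_le (by linarith) hε)
      _ = _ := by
          rw [integral_add (h.const_mul ε) (integrable_const _), integral_const_mul, absMoment]
          simp
  have hle10 : 0 ≤ ∫ v, |v| ^ (s - 1) ∂(μ : Measure ℝ) := integral_nonneg fun v => by positivity
  set ν : Measure ℝ := (μ : Measure ℝ) with hν
  have i1 : Integrable (fun z : ℝ × ℝ => p ^ s * |z.1| ^ s) (ν.prod ν) :=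
    (Integrable.comp_fst (f := fun v : ℝ => |v| ^ s) h ν).const_mul _
  have i2 : Integrable (fun z : ℝ × ℝ => q ^ s * |z.2| ^ s) (ν.prod ν) :=
    (Integrable.comp_snd (f := fun v : ℝ => |v| ^ s) h ν).const_mul _
  have i3 : Integrable (fun z : ℝ × ℝ => s * 2 ^ s * (p ^ (s - 1) * q) *
      (|z.1| ^ (s - 1) * |z.2|)) (ν.prod ν) := (hs1.mul_prod hid).const_mul _
  have i4 : Integrable (fun z : ℝ × ℝ => s * 2 ^ s * (q ^ (s - 1) * p) *
      (|z.1| * |z.2| ^ (s - 1))) (ν.prod ν) := (hid.mul_prod hs1).const_mul _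
  rw [integral_collide p q ν ν (by fun_prop : Measurable fun v : ℝ => |v| ^ s).stronglyMeasurable]
  calc ∫ z : ℝ × ℝ, |p * z.1 + q * z.2| ^ s ∂ν.prod ν
      ≤ ∫ z : ℝ × ℝ, (p ^ s * |z.1| ^ s + q ^ s * |z.2| ^ s +
          s * 2 ^ s * (p ^ (s - 1) * q) * (|z.1| ^ (s - 1) * |z.2|) +
          s * 2 ^ s * (q ^ (s - 1) * p) * (|z.1| * |z.2| ^ (s - 1))) ∂ν.prod ν := by
        refine integral_mono_of_nonneg (ae_of_all _ fun z => by positivity)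
          (((i1.fun_add i2).fun_add i3).fun_add i4) (ae_of_all _ fun z => ?_)
        have h1 : |p * z.1 + q * z.2| ^ s ≤ (p * |z.1| + q * |z.2|) ^ s := by
          refine Real.rpow_le_rpow (abs_nonneg _) ((abs_add_le _ _).trans ?_) (by linarith)
          rw [abs_mul, abs_mul, abs_of_pos hp, abs_of_pos hq]
        refine h1.trans ((add_rpow_le (by positivity) (by positivity) (by linarith)).trans
          (le_of_eq ?_))
        simp only [Real.mul_rpow hp.le (abs_nonneg z.1), Real.mul_rpow hq.le (abs_nonneg z.2)]
        ring
    _ = (p ^ s + q ^ s) * absMoment s μ +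
          s * 2 ^ s * (p ^ (s - 1) * q + q ^ (s - 1) * p) *
            ((∫ v, |v| ^ (s - 1) ∂ν) * ∫ v, |v| ∂ν) := by
        rw [integral_add ((i1.fun_add i2).fun_add i3) i4, integral_add (i1.fun_add i2) i3, integral_add i1 i2]
        simp only [integral_const_mul]
        rw [integral_fun_fst (fun v : ℝ => |v| ^ s), integral_fun_snd (fun v : ℝ => |v| ^ s),
          integral_prod_mul (fun v : ℝ => |v| ^ (s - 1)) (fun v : ℝ => |v|),
          integral_prod_mul (fun v : ℝ => |v|) (fun v : ℝ => |v| ^ (s - 1)), absMoment, ← hν]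
        simp
        ring
    _ ≤ _ := by
        gcongr
        nlinarith

/-- The dissipation of the moment of order `2 + δ` by the collision operator. -/
theorem exists_integral_collide_rpow_le (hp : 0 < p) (hq : 0 < q) {δ : ℝ} (hδ : 0 < δ)
    (hneg : keyFun p q δ < 0) : ∃ k C : ℝ, 0 < k ∧ 0 ≤ C ∧
      (δ ≤ 1 → k = |keyFun p q δ| ∧ C = p ^ 2 * q ^ δ + q ^ 2 * p ^ δ) ∧
      ∀ μ : ProbabilityMeasure ℝ, IsNormalized μ → HasFiniteMoment (2 + δ) μ →
        ∫ v, |v| ^ (2 + δ) ∂collide p q μ μ ≤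
          (1 + (2 + δ) / 2 * (p ^ 2 + q ^ 2 - 1) - k) * absMoment (2 + δ) μ + C := by
  have hk : 0 < |keyFun p q δ| := abs_pos.2 hneg.ne
  have he : p ^ (2 + δ) + q ^ (2 + δ) =
      1 + (2 + δ) / 2 * (p ^ 2 + q ^ 2 - 1) - |keyFun p q δ| := by
    rw [abs_of_neg hneg, keyFun]
    ring
  by_cases hδ1 : δ ≤ 1
  · refine ⟨|keyFun p q δ|, p ^ 2 * q ^ δ + q ^ 2 * p ^ δ, hk, by positivity,
      fun _ => ⟨rfl, rfl⟩, fun μ hμ h => ?_⟩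
    rw [← he]
    exact hμ.integral_collide_rpow_le_of_le_one hp hq hδ hδ1 h
  · set s := 2 + δ with hs
    set K := s * 2 ^ s * (p ^ (s - 1) * q + q ^ (s - 1) * p) with hK
    have hK0 : 0 < K := by positivity
    -- Chosen so that Kε is half the gap: absorbing the mixed terms costs half of |Σ(δ)| and leaves
    -- the other half as the rate.
    set ε := |keyFun p q δ| / 2 / K with hε
    have hε0 : 0 < ε := by positivity
    refine ⟨|keyFun p q δ| / 2, K * ε⁻¹ ^ (s - 1), by positivity, by positivity,
      fun h => absurd h hδ1, fun μ hμ h => ?_⟩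
    have h1 := hμ.integral_collide_rpow_le hp hq (by linarith : 2 ≤ s) h hε0
    rw [← hK, he] at h1
    have h2 : K * ε = |keyFun p q δ| / 2 := by
      rw [hε]
      field_simp
    refine h1.trans (le_of_eq ?_)
    linear_combination absMoment s μ * h2

theorem collide_dilate (a : ℝ) (μ : ProbabilityMeasure ℝ) :
    collide p q (dilate a μ) (dilate a μ) = (collide p q μ μ).map fun v => a * v := by
  rw [collide, dilate_coe, Measure.map_prod_map _ _ (by fun_prop) (by fun_prop),
    Measure.map_map (by fun_prop) (by fun_prop), collide,
    Measure.map_map (by fun_prop) (by fun_prop)]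
  congr 1
  ext z
  simp only [Function.comp_apply, Prod.map_fst, Prod.map_snd]
  ring

theorem integrable_dilate_iff {a : ℝ} {μ : ProbabilityMeasure ℝ} {φ : ℝ → ℝ}
    (hφ : StronglyMeasurable φ) : Integrable φ (dilate a μ : Measure ℝ) ↔
      Integrable (fun v => φ (a * v)) (μ : Measure ℝ) := by
  rw [dilate_coe, integrable_map_measure hφ.aestronglyMeasurable (by fun_prop)]
  rfl

/-! ### Mean, energy and higher moments of the constructed solution -/

section Moments

variable {f₀ : ProbabilityMeasure ℝ} {δ : ℝ}

theorem wildIntegrable_rpow (hp : 0 < p) (hq : 0 < q) (hδ : 0 < δ)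
    (h : HasFiniteMoment (2 + δ) f₀) :
    WildIntegrable p q (f₀ : Measure ℝ) fun v : ℝ => |v| ^ (2 + δ) :=
  wildIntegrable_abs_rpow (by linarith) hp.le hq.le h

theorem wildIntegrable_sq (hp : 0 < p) (hq : 0 < q) (hδ : 0 < δ)
    (h : HasFiniteMoment (2 + δ) f₀) :
    WildIntegrable p q (f₀ : Measure ℝ) fun v : ℝ => v ^ 2 := fun y hy hy1 => by
  have := isProbabilityMeasure_wildSum (p := p) (q := q) (μ := f₀) hy hy1
  exact integrable_sq_of_rpow (by linarith) (wildIntegrable_rpow hp hq hδ h y hy hy1)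

theorem wildIntegrable_id (hp : 0 < p) (hq : 0 < q) (hδ : 0 < δ)
    (h : HasFiniteMoment (2 + δ) f₀) :
    WildIntegrable p q (f₀ : Measure ℝ) fun v : ℝ => v := fun y hy hy1 => by
  have := isProbabilityMeasure_wildSum (p := p) (q := q) (μ := f₀) hy hy1
  exact integrable_id_of_sq (wildIntegrable_sq hp hq hδ h y hy hy1)

/-- The mean m solves m' = (p + q - 1)m. In general it would not be conserved, but zero is
preserved. -/
theorem integral_wildCurve_id (hp : 0 < p) (hq : 0 < q) (hδ : 0 < δ)
    (h : HasFiniteMoment (2 + δ) f₀) (h₀ : IsNormalized f₀) {t : ℝ} (ht : 0 ≤ t) :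
    ∫ v, v ∂(wildCurve p q f₀ t : Measure ℝ) = 0 := by
  have hw := wildIntegrable_id hp hq hδ h
  have h1 := eq_mul_exp_of_hasDerivAt (k := p + q - 1) hw.continuousOn (fun t ht =>
    (hw.hasDerivAt ht).congr_deriv (by
      rw [integral_collide_id (hw.integrable_wildCurve t)]
      ring)) ht
  rw [h1, wildCurve_zero, h₀.mean, zero_mul]

theorem integral_wildCurve_sq (hp : 0 < p) (hq : 0 < q) (hδ : 0 < δ)
    (h : HasFiniteMoment (2 + δ) f₀) (h₀ : IsNormalized f₀) {t : ℝ} (ht : 0 ≤ t) :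
    ∫ v, v ^ 2 ∂(wildCurve p q f₀ t : Measure ℝ) = Real.exp ((p ^ 2 + q ^ 2 - 1) * t) := by
  have hw := wildIntegrable_sq hp hq hδ h
  have h1 := eq_mul_exp_of_hasDerivAt (k := p ^ 2 + q ^ 2 - 1) hw.continuousOn (fun t ht =>
    (hw.hasDerivAt ht).congr_deriv (by
      rw [integral_collide_sq (hw.integrable_wildCurve t)
        (integral_wildCurve_id hp hq hδ h h₀ ht.le)]
      ring)) ht
  rw [h1, wildCurve_zero, h₀.energy, one_mul]

theorem isNormalized_rescaledSolution (hp : 0 < p) (hq : 0 < q) (hδ : 0 < δ)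
    (h : HasFiniteMoment (2 + δ) f₀) (h₀ : IsNormalized f₀) {t : ℝ} (ht : 0 ≤ t) :
    IsNormalized (rescaledSolution p q f₀ t) where
  integrable_sq := by
    rw [rescaledSolution, integrable_dilate_iff (by fun_prop)]
    simp only [mul_pow]
    exact ((wildIntegrable_sq hp hq hδ h).integrable_wildCurve t).const_mul _
  mean := by
    rw [rescaledSolution, integral_dilate _ _ (by fun_prop), integral_const_mul,
      integral_wildCurve_id hp hq hδ h h₀ ht, mul_zero]
  energy := by
    rw [rescaledSolution, integral_dilate _ _ (by fun_prop)]
    simp only [mul_pow]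
    rw [integral_const_mul, integral_wildCurve_sq hp hq hδ h h₀ ht, ← Real.exp_nat_mul,
      ← Real.exp_add, Real.exp_eq_one_iff]
    push_cast
    ring

theorem abs_exp_mul_rpow (a v s : ℝ) : |Real.exp a * v| ^ s = Real.exp (a * s) * |v| ^ s := by
  rw [abs_mul, Real.abs_exp, Real.mul_rpow (Real.exp_pos _).le (abs_nonneg _), Real.exp_mul]

theorem hasFiniteMoment_rescaledSolution (hp : 0 < p) (hq : 0 < q) (hδ : 0 < δ)
    (h : HasFiniteMoment (2 + δ) f₀) (t : ℝ) :
    HasFiniteMoment (2 + δ) (rescaledSolution p q f₀ t) := by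
  rw [HasFiniteMoment, rescaledSolution,
    integrable_dilate_iff (by fun_prop : Measurable fun v : ℝ => |v| ^ (2 + δ)).stronglyMeasurable]
  simp only [abs_exp_mul_rpow]
  exact ((wildIntegrable_rpow hp hq hδ h).integrable_wildCurve t).const_mul _

theorem absMoment_rescaledSolution_le (hp : 0 < p) (hq : 0 < q) (hδ : 0 < δ) {k C : ℝ}
    (hk : 0 < k) (hC : 0 ≤ C)
    (hkC : ∀ μ : ProbabilityMeasure ℝ, IsNormalized μ → HasFiniteMoment (2 + δ) μ →
        ∫ v, |v| ^ (2 + δ) ∂collide p q μ μ ≤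
          (1 + (2 + δ) / 2 * (p ^ 2 + q ^ 2 - 1) - k) * absMoment (2 + δ) μ + C)
    (h : HasFiniteMoment (2 + δ) f₀) (h₀ : IsNormalized f₀) {t : ℝ} (ht : 0 ≤ t) :
    absMoment (2 + δ) (rescaledSolution p q f₀ t) ≤ absMoment (2 + δ) f₀ + C / k := by
  have hw := wildIntegrable_rpow hp hq hδ h
  have hm : StronglyMeasurable fun v : ℝ => |v| ^ (2 + δ) :=
    (by fun_prop : Measurable fun v : ℝ => |v| ^ (2 + δ)).stronglyMeasurable
  set κ := (p ^ 2 + q ^ 2 - 1) / 2 with hκ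
  have hM : ∀ t, absMoment (2 + δ) (rescaledSolution p q f₀ t) =
      Real.exp (-κ * (2 + δ) * t) * ∫ v, |v| ^ (2 + δ) ∂(wildCurve p q f₀ t : Measure ℝ) := by
    intro t
    rw [absMoment, rescaledSolution, integral_dilate _ _ hm]
    simp only [abs_exp_mul_rpow]
    rw [integral_const_mul, ← hκ]
    ring_nf
  have hN : ∀ t, ∫ v, |v| ^ (2 + δ) ∂collide p q (rescaledSolution p q f₀ t)
      (rescaledSolution p q f₀ t) = Real.exp (-κ * (2 + δ) * t) *
        ∫ v, |v| ^ (2 + δ) ∂collide p q (wildCurve p q f₀ t) (wildCurve p q f₀ t) := by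
    intro t
    rw [rescaledSolution, collide_dilate, integral_map (by fun_prop) hm.aestronglyMeasurable]
    simp only [abs_exp_mul_rpow]
    rw [integral_const_mul, ← hκ]
    ring_nf
  have hE : ∀ t : ℝ, HasDerivAt (fun t : ℝ => Real.exp (-κ * (2 + δ) * t))
      (Real.exp (-κ * (2 + δ) * t) * (-κ * (2 + δ))) t := by
    intro t
    simpa using ((hasDerivAt_id t).const_mul (-κ * (2 + δ))).exp
  have hinit := (isWeakSolution_rescaledSolution p q f₀).initial
  -- The drift contributes -(2+δ)κM, exactly the amount by which `hkC` allows the gain to exceed M,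
  -- so M' ≤ -kM + C remains.
  have hfin := le_add_div_of_hasDerivAt
    (x := fun t => absMoment (2 + δ) (rescaledSolution p q f₀ t))
    (x' := fun t => -κ * (2 + δ) * absMoment (2 + δ) (rescaledSolution p q f₀ t) +
      (∫ v, |v| ^ (2 + δ) ∂collide p q (rescaledSolution p q f₀ t) (rescaledSolution p q f₀ t) -
        absMoment (2 + δ) (rescaledSolution p q f₀ t))) hk hC
    (integral_nonneg fun v => by positivity) ?_ ?_ ?_ ht
  · simpa only [hinit] using hfin
  · simp only [hM]
    exact ContinuousOn.mul (by fun_prop) hw.continuousOn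
  · intro t ht
    simp only [hM, hN]
    exact ((hE t).mul (hw.hasDerivAt ht)).congr_deriv (by ring)
  · intro t ht
    have h1 := hkC _ (isNormalized_rescaledSolution hp hq hδ h h₀ ht.le)
      (hasFiniteMoment_rescaledSolution hp hq hδ h t)
    rw [hκ]
    linarith

end Moments

end MaxwellKinetic

end

/-! ### Taylor expansion of characteristic functions at the origin -/

noncomputable section

namespace MaxwellKinetic

variable {p q : ℝ}

theorem norm_charFun_sub_taylor_le {μ : ProbabilityMeasure ℝ} {η : ℝ} (hη : 0 < η) (hη1 : η ≤ 1)
    (h : HasFiniteMoment (2 + η) μ) (ξ : ℝ) :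
    ‖charFun (μ : Measure ℝ) ξ - (1 + ξ * (∫ v, v ∂(μ : Measure ℝ) : ℝ) * Complex.I -
      ξ ^ 2 / 2 * (∫ v, v ^ 2 ∂(μ : Measure ℝ) : ℝ))‖ ≤
      4 * absMoment (2 + η) μ * |ξ| ^ (2 + η) := by
  have hsq := integrable_sq_of_rpow (by linarith) h
  have hid := integrable_id_of_sq hsq
  have i0 : Integrable (fun v : ℝ => Complex.exp (ξ * v * Complex.I)) (μ : Measure ℝ) :=
    Integrable.of_bound (by fun_prop) 1 (ae_of_all _ fun v => by
      rw [← Complex.ofReal_mul, Complex.norm_exp_ofReal_mul_I])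
  have i1 : Integrable (fun v : ℝ => ξ * (v : ℂ) * Complex.I) (μ : Measure ℝ) :=
    (hid.ofReal.const_mul _).mul_const _
  have i2 : Integrable (fun v : ℝ => (ξ : ℂ) ^ 2 / 2 * ((v ^ 2 : ℝ) : ℂ)) (μ : Measure ℝ) :=
    hsq.ofReal.const_mul _
  have e : charFun (μ : Measure ℝ) ξ - (1 + ξ * (∫ v, v ∂(μ : Measure ℝ) : ℝ) * Complex.I -
      ξ ^ 2 / 2 * (∫ v, v ^ 2 ∂(μ : Measure ℝ) : ℝ)) =
      ∫ v : ℝ, (Complex.exp (ξ * v * Complex.I) - 1 - ξ * (v : ℂ) * Complex.I +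
        (ξ : ℂ) ^ 2 / 2 * ((v ^ 2 : ℝ) : ℂ)) ∂(μ : Measure ℝ) := by
    have i01 : Integrable (fun v : ℝ => Complex.exp (ξ * v * Complex.I) - 1) (μ : Measure ℝ) :=
      i0.sub (integrable_const 1)
    have i012 : Integrable (fun v : ℝ => Complex.exp (ξ * v * Complex.I) - 1 -
      ξ * (v : ℂ) * Complex.I) (μ : Measure ℝ) := i01.sub i1
    rw [integral_add i012 i2, integral_sub i01 i1, integral_sub i0 (integrable_const 1),
      integral_const_mul, integral_mul_const, integral_const_mul, integral_complex_ofReal,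
      integral_complex_ofReal, charFun_apply_real]
    simp
    ring
  rw [e]
  calc _ ≤ ∫ v, 4 * (|ξ| ^ (2 + η) * |v| ^ (2 + η)) ∂(μ : Measure ℝ) := by
        refine norm_integral_le_of_norm_le ((h.const_mul _).const_mul _) (ae_of_all _ fun v => ?_)
        have h1 := norm_exp_sub_taylor_two_le hη.le hη1 (ξ * v)
        rw [abs_mul, Real.mul_rpow (abs_nonneg _) (abs_nonneg _)] at h1
        refine le_trans (le_of_eq ?_) h1
        congr 1
        push_cast
        ring
    _ = _ := by
        rw [integral_const_mul, integral_const_mul, absMoment]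
        ring

/-- Normalized laws share the Taylor polynomial 1 - ξ²/2, so only the two remainders are left. -/
theorem IsNormalized.norm_charFun_sub_le {μ ν : ProbabilityMeasure ℝ} (hμ : IsNormalized μ)
    (hν : IsNormalized ν) {η : ℝ} (hη : 0 < η) (hη1 : η ≤ 1) (h : HasFiniteMoment (2 + η) μ)
    (h' : HasFiniteMoment (2 + η) ν) (ξ : ℝ) :
    ‖charFun (μ : Measure ℝ) ξ - charFun (ν : Measure ℝ) ξ‖ ≤
      4 * (absMoment (2 + η) μ + absMoment (2 + η) ν) * |ξ| ^ (2 + η) := by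
  have h1 := norm_charFun_sub_taylor_le hη hη1 h ξ
  have h2 := norm_charFun_sub_taylor_le hη hη1 h' ξ
  rw [hμ.mean, hμ.energy] at h1
  rw [hν.mean, hν.energy] at h2
  have h3 := norm_sub_le_norm_sub_add_norm_sub (charFun (μ : Measure ℝ) ξ)
    (1 + ξ * ((0 : ℝ) : ℂ) * Complex.I - ξ ^ 2 / 2 * ((1 : ℝ) : ℂ)) (charFun (ν : Measure ℝ) ξ)
  rw [norm_sub_rev (_ - _) (charFun (ν : Measure ℝ) ξ)] at h3
  linarith

theorem eq_zero_of_abs_mul_rpow_le {x K r s : ℝ} (hrs : r < s)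
    (h : ∀ ξ : ℝ, 0 < ξ → |x| * ξ ^ r ≤ K * ξ ^ s) : x = 0 := by
  have h1 : ∀ ξ : ℝ, 0 < ξ → |x| ≤ K * ξ ^ (s - r) := by
    intro ξ hξ
    have h2 := h ξ hξ
    have h3 : 0 < ξ ^ r := Real.rpow_pos_of_pos hξ r
    rw [Real.rpow_sub hξ, ← mul_div_assoc, le_div_iff₀ h3]
    exact h2
  have h2 : Tendsto (fun ξ : ℝ => K * ξ ^ (s - r)) (𝓝[>] 0) (𝓝 (K * 0)) := by
    have := (Real.continuousAt_rpow_const 0 (s - r) (Or.inr (by linarith))).tendsto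
    rw [Real.zero_rpow (by linarith)] at this
    exact (this.const_mul K).mono_left nhdsWithin_le_nhds
  rw [mul_zero] at h2
  have h3 : |x| ≤ 0 := ge_of_tendsto h2 (by
    filter_upwards [self_mem_nhdsWithin] with ξ hξ using h1 ξ hξ)
  exact abs_nonpos_iff.1 h3

/-- Measures at finite Fourier distance of order `2 + η` have the same mean and energy. -/
theorem IsNormalized.of_norm_charFun_sub_le {μ ν : ProbabilityMeasure ℝ} (hν : IsNormalized ν)
    {η K : ℝ} (hη : 0 < η) (hη1 : η ≤ 1) (h : HasFiniteMoment (2 + η) μ)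
    (h' : HasFiniteMoment (2 + η) ν)
    (hle : ∀ ξ : ℝ, ‖charFun (μ : Measure ℝ) ξ - charFun (ν : Measure ℝ) ξ‖ ≤
      K * |ξ| ^ (2 + η)) : IsNormalized μ := by
  set m := ∫ v, v ∂(μ : Measure ℝ) with hm
  set e := ∫ v, v ^ 2 ∂(μ : Measure ℝ) with he
  set L := 4 * absMoment (2 + η) μ + K + 4 * absMoment (2 + η) ν with hL
  -- The difference of the two Taylor polynomials. Its imaginary part has order ξ and its real part
  -- order ξ², both lower than 2 + η, so each coefficient must vanish.
  have hdiff : ∀ ξ : ℝ, ‖(((1 - e) / 2 * ξ ^ 2 : ℝ) : ℂ) + ((m * ξ : ℝ) : ℂ) * Complex.I‖ ≤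
      L * |ξ| ^ (2 + η) := by
    intro ξ
    have h1 := norm_charFun_sub_taylor_le hη hη1 h ξ
    have h2 := norm_charFun_sub_taylor_le hη hη1 h' ξ
    have h3 := hle ξ
    rw [hν.mean, hν.energy] at h2
    rw [← hm, ← he, norm_sub_rev] at h1
    refine le_trans (le_of_eq ?_) ((norm_add₃_le (a := _) (b := _) (c := _)).trans
      ((add_le_add (add_le_add h1 h3) h2).trans (le_of_eq ?_)))
    · congr 1
      push_cast
      ring
    · rw [hL]
      ring
  have hm0 : m = 0 := by
    refine eq_zero_of_abs_mul_rpow_le (K := L) (r := 1) (s := 2 + η) (by linarith) fun ξ hξ => ?_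
    have h1 := (Complex.abs_im_le_norm _).trans (hdiff ξ)
    rw [Complex.add_im, Complex.ofReal_im, Complex.im_ofReal_mul, Complex.I_im, zero_add, mul_one,
      abs_mul, abs_of_pos hξ] at h1
    rwa [Real.rpow_one]
  have he0 : (1 - e) / 2 = 0 := by
    refine eq_zero_of_abs_mul_rpow_le (K := L) (r := 2) (s := 2 + η) (by linarith) fun ξ hξ => ?_
    have h1 := (Complex.abs_re_le_norm _).trans (hdiff ξ)
    rw [Complex.add_re, Complex.ofReal_re, Complex.re_ofReal_mul, Complex.I_re, mul_zero, add_zero,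
      abs_mul, abs_of_pos (by positivity : 0 < ξ ^ 2), abs_of_pos hξ] at h1
    rwa [Real.rpow_two]
  exact ⟨integrable_sq_of_rpow (by linarith) h, hm0, by linarith⟩

/-! ### Existence of the stationary law -/

/-- Absolute moments are lower semicontinuous under weak convergence, by the portmanteau inequality
on open sets. -/
theorem hasFiniteMoment_of_tendsto {μ : ProbabilityMeasure ℝ} {μs : ℕ → ProbabilityMeasure ℝ}
    (hlim : Tendsto μs atTop (𝓝 μ)) {s c : ℝ} (hs : 0 ≤ s) (h : ∀ n, HasFiniteMoment s (μs n))
    (hc : ∀ n, absMoment s (μs n) ≤ c) : HasFiniteMoment s μ := by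
  have hcont : Continuous fun v : ℝ => |v| ^ s := by fun_prop (disch := simp [hs])
  have h1 := lintegral_le_liminf_lintegral_of_forall_isOpen_measure_le_liminf_measure
    (μ := (μ : Measure ℝ)) (μs := fun n => (μs n : Measure ℝ)) hcont (fun v => by
      simp only [Pi.zero_apply]
      positivity)
    fun G hG => ProbabilityMeasure.le_liminf_measure_open_of_tendsto hlim hG
  refine ⟨hcont.aestronglyMeasurable, ?_⟩
  rw [hasFiniteIntegral_iff_ofReal (ae_of_all _ fun v => by positivity)]
  refine (h1.trans (liminf_le_of_le (a := ENNReal.ofReal c) (by isBoundedDefault) ?_)).trans_lt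
    ENNReal.ofReal_lt_top
  intro b hb
  obtain ⟨n, hn⟩ := hb.exists
  refine hn.trans ?_
  rw [← ofReal_integral_eq_lintegral_ofReal (h n) (ae_of_all _ fun v => by positivity)]
  exact ENNReal.ofReal_le_ofReal (hc n)

/-- A sequence whose characteristic functions converge locally uniformly at the origin has a
weakly convergent subsequence. -/
theorem exists_tendsto_subseq_of_tendsto_charFun {μs : ℕ → ProbabilityMeasure ℝ} {Φ : ℝ → ℂ}
    (hΦ : ContinuousAt Φ 0)
    (h : ∀ ξ, Tendsto (fun n => charFun (μs n : Measure ℝ) ξ) atTop (𝓝 (Φ ξ))) :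
    ∃ μ : ProbabilityMeasure ℝ, (∀ ξ, charFun (μ : Measure ℝ) ξ = Φ ξ) ∧
      ∃ k : ℕ → ℕ, StrictMono k ∧ Tendsto (μs ∘ k) atTop (𝓝 μ) := by
  have htight := isTightMeasureSet_of_tendsto_charFun (μ := fun n => (μs n : Measure ℝ)) hΦ h
  have hcomp : IsCompact (closure (Set.range μs)) := by
    refine isCompact_closure_of_isTightMeasureSet (htight.subset ?_)
    rintro _ ⟨ν, ⟨n, rfl⟩, rfl⟩
    exact ⟨n, rfl⟩
  obtain ⟨μ, -, k, hk, hlim⟩ := hcomp.tendsto_subseq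
    (fun n => subset_closure (Set.mem_range_self n))
  refine ⟨μ, fun ξ => ?_, k, hk, hlim⟩
  exact tendsto_nhds_unique (ProbabilityMeasure.tendsto_iff_tendsto_charFun.1 hlim ξ)
    ((h ξ).comp hk.tendsto_atTop)

/-- The standard Gaussian law. -/
def stdGaussian : ProbabilityMeasure ℝ :=
  ⟨ProbabilityTheory.gaussianReal 0 1, inferInstance⟩

theorem hasFiniteMoment_stdGaussian {s : ℝ} (hs : 0 ≤ s) : HasFiniteMoment s stdGaussian := by
  have h := (ProbabilityTheory.memLp_id_gaussianReal (μ := 0) (v := 1) ⟨s, hs⟩).integrable_norm_rpow'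
  exact h

theorem isNormalized_stdGaussian : IsNormalized stdGaussian where
  integrable_sq := integrable_sq_of_rpow le_rfl (hasFiniteMoment_stdGaussian zero_le_two)
  mean := ProbabilityTheory.integral_id_gaussianReal
  energy := by
    have h := ProbabilityTheory.variance_fun_id_gaussianReal (μ := 0) (v := 1)
    rw [ProbabilityTheory.variance_of_integral_eq_zero (by fun_prop)
      ProbabilityTheory.integral_id_gaussianReal] at h
    exact h.trans NNReal.coe_one

theorem tendsto_exp_mul_natCast {k : ℝ} (hk : k < 0) (a : ℝ) :
    Tendsto (fun n : ℕ => a * Real.exp (k * n)) atTop (𝓝 0) := by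
  have h : Tendsto (fun n : ℕ => a * Real.exp (k * n)) atTop (𝓝 (a * 0)) :=
    (Real.tendsto_exp_atBot.comp
      (tendsto_natCast_atTop_atTop.const_mul_atTop_of_neg hk)).const_mul a
  rwa [mul_zero] at h

/-- A weak limit of a solution, approached exponentially fast, is stationary. -/
theorem isStationary_of_norm_charFun_sub_le (hp : 0 < p) (hq : 0 < q) {η A : ℝ}
    (hA : 0 ≤ A) (hneg : keyFun p q η < 0) {f₀ μ : ProbabilityMeasure ℝ}
    {g : ℝ → ProbabilityMeasure ℝ} (hg : IsWeakSolution p q f₀ g)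
    (hbd : ∀ t ξ : ℝ, 0 ≤ t → ‖charFun (g t : Measure ℝ) ξ - charFun (f₀ : Measure ℝ) ξ‖ ≤
      A * |ξ| ^ (2 + η))
    (hlim : ∀ (n : ℕ) (ξ : ℝ), ‖charFun (μ : Measure ℝ) ξ - charFun (g n : Measure ℝ) ξ‖ ≤
      A * |ξ| ^ (2 + η) * Real.exp (keyFun p q η * n)) : IsStationary p q μ := by
  have hS := isWeakSolution_rescaledSolution p q μ
  have hconst : ∀ t, 0 ≤ t → rescaledSolution p q μ t = μ := by
    intro t ht
    refine ext_of_charFun fun ξ => sub_eq_zero.1 (norm_le_zero_iff.1 ?_)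
    -- The path from the evolved `μ` to `μ` runs through `g (t + n)` and `g n`; each of the three
    -- legs is at most A|ξ|^{2+η}e^{Σ(η)n}, by contraction from `hlim`, contraction from `hbd`, and
    -- `hlim` itself.
    have hle : ∀ n : ℕ, ‖charFun (rescaledSolution p q μ t : Measure ℝ) ξ -
        charFun (μ : Measure ℝ) ξ‖ ≤
        3 * (A * |ξ| ^ (2 + η)) * Real.exp (keyFun p q η * n) := by
      intro n
      have hn : (0 : ℝ) ≤ n := n.cast_nonneg
      have h1 := hS.norm_charFun_sub_le hp hq (hg.shift hn) (a := 0)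
        (b := A * Real.exp (keyFun p q η * n)) (δ := η) le_rfl (by positivity)
        (fun ξ => (hlim n ξ).trans (le_of_eq (by ring))) ht ξ
      have h2 := (hg.shift ht).norm_charFun_sub_le hp hq hg (a := 0) (b := A) (δ := η) le_rfl hA
        (fun ξ => (hbd t ξ ht).trans (le_of_eq (by ring))) hn ξ
      have h3 := hlim n ξ
      have h4 : Real.exp (keyFun p q η * t) ≤ 1 :=
        Real.exp_le_one_iff.2 (mul_nonpos_of_nonpos_of_nonneg hneg.le ht)
      have h5 : A * Real.exp (keyFun p q η * n) * |ξ| ^ (2 + η) * Real.exp (keyFun p q η * t) ≤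
          A * Real.exp (keyFun p q η * n) * |ξ| ^ (2 + η) * 1 := by gcongr
      rw [add_comm (n : ℝ) t] at h2
      rw [norm_sub_rev] at h3
      have h6 := norm_sub_le_norm_sub_add_norm_sub
        (charFun (rescaledSolution p q μ t : Measure ℝ) ξ)
        (charFun (g (t + n) : Measure ℝ) ξ) (charFun (μ : Measure ℝ) ξ)
      have h7 := norm_sub_le_norm_sub_add_norm_sub (charFun (g (t + n) : Measure ℝ) ξ)
        (charFun (g n : Measure ℝ) ξ) (charFun (μ : Measure ℝ) ξ)
      simp only [zero_mul, zero_add] at h1 h2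
      linarith
    exact ge_of_tendsto' (tendsto_exp_mul_natCast hneg _) hle
  intro φ hφ hs
  have h1 := hS.weak_eq φ hφ hs 1 one_pos
  have h2 : HasDerivAt (fun s => ∫ v, φ v ∂(rescaledSolution p q μ s : Measure ℝ)) 0 1 := by
    refine (hasDerivAt_const 1 (∫ v, φ v ∂(μ : Measure ℝ))).congr_of_eventuallyEq ?_
    filter_upwards [eventually_ge_nhds one_pos] with s hs
    rw [hconst s hs]
  have h3 := h1.unique h2
  rwa [hconst 1 zero_le_one] at h3

theorem HasFiniteMoment.mono {μ : ProbabilityMeasure ℝ} {r s : ℝ} (h : HasFiniteMoment s μ)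
    (hr : 0 ≤ r) (hrs : r ≤ s) : HasFiniteMoment r μ :=
  integrable_abs_rpow_of_le hr hrs h

/-- The Gaussian is merely a convenient normalized start with all moments. Two exponents are in
play: the Taylor bound, hence the contraction argument, requires η ≤ 1, while the moment of order 2
+ δ passes to the limit separately, by semicontinuity. -/
theorem exists_stationary (hp : 0 < p) (hq : 0 < q) {δ : ℝ} (hδ : 0 < δ)
    (hneg : keyFun p q δ < 0) : ∃ μ : ProbabilityMeasure ℝ, IsNormalized μ ∧
      IsStationary p q μ ∧ HasFiniteMoment (2 + δ) μ := by
  set η := min δ 1 with hη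
  have hη0 : 0 < η := lt_min hδ one_pos
  have hηδ : η ≤ δ := min_le_left _ _
  have hη1 : η ≤ 1 := min_le_right _ _
  have hnegη := keyFun_neg hp hq hδ hneg hη0 hηδ
  obtain ⟨k, C, hk, hC, -, hkC⟩ := exists_integral_collide_rpow_le hp hq hδ hneg
  obtain ⟨k', C', hk', hC', -, hkC'⟩ := exists_integral_collide_rpow_le hp hq hη0 hnegη
  have hG := isNormalized_stdGaussian
  have hGδ : HasFiniteMoment (2 + δ) stdGaussian := hasFiniteMoment_stdGaussian (by linarith)
  have hGη : HasFiniteMoment (2 + η) stdGaussian := hasFiniteMoment_stdGaussian (by linarith)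
  set g := rescaledSolution p q stdGaussian with hgdef
  have hg : IsWeakSolution p q stdGaussian g := isWeakSolution_rescaledSolution p q stdGaussian
  set A := 4 * (absMoment (2 + η) stdGaussian + C' / k' + absMoment (2 + η) stdGaussian) with hA
  have hM0 : 0 ≤ absMoment (2 + η) stdGaussian := integral_nonneg fun v => by positivity
  have hA0 : 0 ≤ A := by positivity
  have hbd : ∀ t ξ : ℝ, 0 ≤ t → ‖charFun (g t : Measure ℝ) ξ -
      charFun (stdGaussian : Measure ℝ) ξ‖ ≤ A * |ξ| ^ (2 + η) := by
    intro t ξ ht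
    refine ((isNormalized_rescaledSolution hp hq hη0 hGη hG ht).norm_charFun_sub_le hG hη0 hη1
      (hasFiniteMoment_rescaledSolution hp hq hη0 hGη t) hGη ξ).trans ?_
    have := absMoment_rescaledSolution_le hp hq hη0 hk' hC' hkC' hGη hG ht
    refine mul_le_mul_of_nonneg_right ?_ (by positivity)
    rw [hA]
    linarith
  have hcauchy : ∀ (n : ℕ) (t ξ : ℝ), 0 ≤ t → ‖charFun (g (n + t) : Measure ℝ) ξ -
      charFun (g n : Measure ℝ) ξ‖ ≤ A * |ξ| ^ (2 + η) * Real.exp (keyFun p q η * n) := by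
    intro n t ξ ht
    have h2 := (hg.shift ht).norm_charFun_sub_le hp hq hg (a := 0) (b := A) (δ := η) le_rfl hA0
      (fun ξ => (hbd t ξ ht).trans (le_of_eq (by ring))) n.cast_nonneg ξ
    simpa only [zero_mul, zero_add] using h2
  have hseq : ∀ (n m : ℕ) (ξ : ℝ), n ≤ m → ‖charFun (g m : Measure ℝ) ξ -
      charFun (g n : Measure ℝ) ξ‖ ≤ A * |ξ| ^ (2 + η) * Real.exp (keyFun p q η * n) := by
    intro n m ξ hnm
    have h := hcauchy n (m - n) ξ (sub_nonneg.2 (by exact_mod_cast hnm))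
    rwa [add_sub_cancel] at h
  have hconv : ∀ ξ, ∃ z, Tendsto (fun n : ℕ => charFun (g n : Measure ℝ) ξ) atTop (𝓝 z) := by
    intro ξ
    refine cauchySeq_tendsto_of_complete (cauchySeq_of_le_tendsto_0'
      (fun n : ℕ => A * |ξ| ^ (2 + η) * Real.exp (keyFun p q η * n)) (fun n m hnm => ?_)
      (tendsto_exp_mul_natCast hnegη _))
    rw [dist_comm, dist_eq_norm]
    exact hseq n m ξ hnm
  choose Φ hΦ using hconv
  have hlim : ∀ (n : ℕ) (ξ : ℝ), ‖Φ ξ - charFun (g n : Measure ℝ) ξ‖ ≤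
      A * |ξ| ^ (2 + η) * Real.exp (keyFun p q η * n) := by
    intro n ξ
    refine le_of_tendsto ((hΦ ξ).sub_const _).norm ?_
    filter_upwards [eventually_ge_atTop n] with m hm using hseq n m ξ hm
  have hlim0 : ∀ ξ : ℝ, ‖Φ ξ - charFun (stdGaussian : Measure ℝ) ξ‖ ≤ A * |ξ| ^ (2 + η) := by
    intro ξ
    have h := hlim 0 ξ
    simpa [hg.initial] using h
  have hΦc : ContinuousAt Φ 0 := by
    have h1 : Tendsto (fun ξ : ℝ => A * |ξ| ^ (2 + η)) (𝓝 0) (𝓝 0) := by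
      have hc : Continuous fun ξ : ℝ => A * |ξ| ^ (2 + η) := by
        have : Continuous fun ξ : ℝ => |ξ| ^ (2 + η) :=
          continuous_abs.rpow_const fun _ => Or.inr (by linarith)
        fun_prop
      have := hc.tendsto 0
      rwa [abs_zero, Real.zero_rpow (by linarith), mul_zero] at this
    have h2 : Tendsto (fun ξ => Φ ξ - charFun (stdGaussian : Measure ℝ) ξ) (𝓝 0) (𝓝 0) :=
      squeeze_zero_norm hlim0 h1
    have h3 : Tendsto (charFun (stdGaussian : Measure ℝ)) (𝓝 0)
        (𝓝 (charFun (stdGaussian : Measure ℝ) 0)) := continuous_charFun.tendsto 0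
    have h4 := h2.add h3
    have h5 : Φ 0 = charFun (stdGaussian : Measure ℝ) 0 := by
      have h := hlim0 0
      rw [abs_zero, Real.zero_rpow (by linarith), mul_zero] at h
      exact sub_eq_zero.1 (norm_le_zero_iff.1 h)
    rw [ContinuousAt, h5]
    simpa using h4
  obtain ⟨μ, hμΦ, κ, -, hκ⟩ := exists_tendsto_subseq_of_tendsto_charFun
    (μs := fun n : ℕ => g n) hΦc hΦ
  simp only [← hμΦ] at hlim hlim0
  have hμδ : HasFiniteMoment (2 + δ) μ := hasFiniteMoment_of_tendsto hκ (by linarith)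
    (fun n => hasFiniteMoment_rescaledSolution hp hq hδ hGδ _)
    (fun n => absMoment_rescaledSolution_le hp hq hδ hk hC hkC hGδ hG (Nat.cast_nonneg _))
  exact ⟨μ, hG.of_norm_charFun_sub_le hη0 hη1 (hμδ.mono (by linarith) (by linarith)) hGη hlim0,
    isStationary_of_norm_charFun_sub_le hp hq hA0 hnegη hg hbd hlim, hμδ⟩

/-! ### Uniqueness of the stationary law -/

theorem IsNormalized.isLittleO_charFun_sub {μ ν : ProbabilityMeasure ℝ} (hμ : IsNormalized μ)
    (hν : IsNormalized ν) :
    (fun ξ => charFun (μ : Measure ℝ) ξ - charFun (ν : Measure ℝ) ξ) =o[𝓝 0]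
      fun ξ : ℝ => ξ ^ 2 := by
  have h : ∀ {μ : ProbabilityMeasure ℝ}, IsNormalized μ →
      (fun ξ : ℝ => charFun (μ : Measure ℝ) ξ - (1 - (ξ : ℂ) ^ 2 / 2)) =o[𝓝 0]
        fun ξ : ℝ => ξ ^ 2 := by
    intro μ hμ
    have := taylor_charFun_two (P := (μ : Measure ℝ)) (X := id) aemeasurable_id
      (by simpa using hμ.mean) (by simpa using hμ.energy)
    simpa [Measure.map_id] using this
  refine ((h hμ).sub (h hν)).congr_left fun ξ => ?_
  ring

theorem IsStationary.unique (hp : 0 < p) (hq : 0 < q) {δ : ℝ} (hδ : 0 < δ)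
    (hneg : keyFun p q δ < 0) {μ ν : ProbabilityMeasure ℝ} (hμ : IsNormalized μ)
    (hν : IsNormalized ν) (hμs : IsStationary p q μ) (hνs : IsStationary p q ν) : μ = ν := by
  refine ext_of_charFun fun ξ => sub_eq_zero.1 (norm_le_zero_iff.1 ?_)
  have key : ∀ ε : ℝ, 0 < ε → ‖charFun (μ : Measure ℝ) ξ - charFun (ν : Measure ℝ) ξ‖ ≤
      ε * |ξ| ^ (2 : ℝ) := by
    intro ε hε
    obtain ⟨r, hr, hball⟩ := Metric.eventually_nhds_iff.1
      ((hμ.isLittleO_charFun_sub hν).bound hε)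
    -- Two normalized laws may be at infinite distance of order 2 + δ. Within radius `r` the bound
    -- o(ξ²) is used; beyond it the trivial bound 2 is at most b|ξ|^{2+δ}.
    set b := 2 / r ^ (2 + δ) with hb
    have hb0 : 0 ≤ b := by positivity
    have h0 : ∀ ξ : ℝ, ‖charFun (μ : Measure ℝ) ξ - charFun (ν : Measure ℝ) ξ‖ ≤
        ε * |ξ| ^ (2 : ℝ) + b * |ξ| ^ (2 + δ) := by
      intro ξ
      have hx : 0 ≤ ε * |ξ| ^ (2 : ℝ) := by positivity
      have hy : 0 ≤ b * |ξ| ^ (2 + δ) := by positivity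
      rcases lt_or_ge |ξ| r with h | h
      · have h1 := hball (by simpa using h : dist ξ 0 < r)
        rw [norm_pow, Real.norm_eq_abs, ← Real.rpow_two] at h1
        linarith
      · have h1 : r ^ (2 + δ) ≤ |ξ| ^ (2 + δ) := Real.rpow_le_rpow hr.le h (by linarith)
        have h2 : 2 ≤ b * |ξ| ^ (2 + δ) := by
          rw [hb, div_mul_eq_mul_div, le_div_iff₀ (by positivity)]
          linarith
        have h3 := norm_sub_le (charFun (μ : Measure ℝ) ξ) (charFun (ν : Measure ℝ) ξ)
        have h4 := norm_charFun_le_one (μ := (μ : Measure ℝ)) ξ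
        have h5 := norm_charFun_le_one (μ := (ν : Measure ℝ)) ξ
        linarith
    have h1 : ∀ n : ℕ, ‖charFun (μ : Measure ℝ) ξ - charFun (ν : Measure ℝ) ξ‖ ≤
        ε * |ξ| ^ (2 : ℝ) + b * |ξ| ^ (2 + δ) * Real.exp (keyFun p q δ * n) := fun n =>
      hμs.isWeakSolution.norm_charFun_sub_le hp hq hνs.isWeakSolution hε.le hb0 h0
        n.cast_nonneg ξ
    have h2 := (tendsto_exp_mul_natCast hneg (b * |ξ| ^ (2 + δ))).const_add (ε * |ξ| ^ (2 : ℝ))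
    rw [add_zero] at h2
    exact ge_of_tendsto' h2 h1
  have h3 : Tendsto (fun ε : ℝ => ε * |ξ| ^ (2 : ℝ)) (𝓝[>] 0) (𝓝 0) := by
    have : Tendsto (fun ε : ℝ => ε * |ξ| ^ (2 : ℝ)) (𝓝 0) (𝓝 (0 * |ξ| ^ (2 : ℝ))) :=
      Continuous.tendsto (by fun_prop) 0
    rw [zero_mul] at this
    exact this.mono_left nhdsWithin_le_nhds
  exact ge_of_tendsto h3 (by filter_upwards [self_mem_nhdsWithin] with ε hε using key ε hε)

/-! ### Estimates in the Fourier metric -/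

theorem fourierDist_le_ofReal_iff {μ ν : ProbabilityMeasure ℝ} {s b : ℝ} (hs : 0 < s)
    (hb : 0 ≤ b) : fourierDist s μ ν ≤ ENNReal.ofReal b ↔
      ∀ ξ : ℝ, ‖charFun (μ : Measure ℝ) ξ - charFun (ν : Measure ℝ) ξ‖ ≤ b * |ξ| ^ s := by
  simp only [fourierDist, iSup_le_iff, ENNReal.ofReal_le_ofReal_iff hb]
  refine forall_congr' fun ξ => ?_
  by_cases hξ : ξ = 0
  · subst hξ
    simp [Real.zero_rpow hs.ne']
  · have h : 0 < |ξ| ^ s := Real.rpow_pos_of_pos (abs_pos.2 hξ) s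
    rw [div_le_iff₀ h]
    exact ⟨fun h => h hξ, fun h _ => h⟩

theorem IsWeakSolution.fourierDist_le (hp : 0 < p) (hq : 0 < q) {f₀ f₁ : ProbabilityMeasure ℝ}
    {g₀ g₁ : ℝ → ProbabilityMeasure ℝ} (h₀ : IsWeakSolution p q f₀ g₀)
    (h₁ : IsWeakSolution p q f₁ g₁) {δ : ℝ} (hδ : 0 < δ) (hneg : keyFun p q δ < 0) {t : ℝ}
    (ht : 0 ≤ t) : fourierDist (2 + δ) (g₀ t) (g₁ t) ≤
      fourierDist (2 + δ) f₀ f₁ * ENNReal.ofReal (Real.exp (-|keyFun p q δ| * t)) := by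
  by_cases htop : fourierDist (2 + δ) f₀ f₁ = ⊤
  -- Since 0 · ∞ = 0, the exponential factor must be shown to be nonzero.
  · rw [htop, ENNReal.top_mul (by
      rw [ne_eq, ENNReal.ofReal_eq_zero, not_le]
      exact Real.exp_pos _)]
    exact le_top
  · set b := (fourierDist (2 + δ) f₀ f₁).toReal with hb
    have hb0 : 0 ≤ b := ENNReal.toReal_nonneg
    have hfb : fourierDist (2 + δ) f₀ f₁ = ENNReal.ofReal b := (ENNReal.ofReal_toReal htop).symm
    have h := (fourierDist_le_ofReal_iff (by linarith) hb0).1 hfb.le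
    rw [hfb, ← ENNReal.ofReal_mul hb0, fourierDist_le_ofReal_iff (by linarith) (by positivity)]
    intro ξ
    have h2 := h₀.norm_charFun_sub_le hp hq h₁ (a := 0) (b := b) (δ := δ) le_rfl hb0
      (fun ξ => (h ξ).trans (le_of_eq (by ring))) ht ξ
    rw [abs_of_neg hneg, neg_neg]
    refine h2.trans (le_of_eq ?_)
    ring

theorem IsNormalized.fourierDist_lt_top {μ ν : ProbabilityMeasure ℝ} (hμ : IsNormalized μ)
    (hν : IsNormalized ν) {η : ℝ} (hη : 0 < η) (hη1 : η ≤ 1) (h : HasFiniteMoment (2 + η) μ)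
    (h' : HasFiniteMoment (2 + η) ν) : fourierDist (2 + η) μ ν < ⊤ := by
  have hM : 0 ≤ absMoment (2 + η) μ := integral_nonneg fun v => by positivity
  have hM' : 0 ≤ absMoment (2 + η) ν := integral_nonneg fun v => by positivity
  exact ((fourierDist_le_ofReal_iff (by linarith) (by positivity)).2
    (hμ.norm_charFun_sub_le hν hη hη1 h h')).trans_lt ENNReal.ofReal_lt_top

end MaxwellKinetic

end

/-! ### The main theorem -/

theorem mainTheorem1 (p q δ : ℝ) (hq : 0 < q) (hpq : q < p) (hδ : 0 < δ)
    (hneg : MaxwellKinetic.keyFun p q δ < 0) :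
    -- the unique normalized stationary solution, which has a finite moment of order `2 + δ`
    ∃ gInf : ProbabilityMeasure ℝ,
      MaxwellKinetic.IsNormalized gInf ∧
      MaxwellKinetic.IsStationary p q gInf ∧
      MaxwellKinetic.HasFiniteMoment (2 + δ) gInf ∧
      (∀ μ : ProbabilityMeasure ℝ, MaxwellKinetic.IsNormalized μ →
        MaxwellKinetic.IsStationary p q μ → μ = gInf) ∧
      -- the moment bound, as a function of the initial moment
      ∃ c : ℝ → ℝ,
        (δ ≤ 1 → ∀ m : ℝ, c m =
          m + (p ^ 2 * q ^ δ + q ^ 2 * p ^ δ) / |MaxwellKinetic.keyFun p q δ|) ∧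
        ∀ f₀ : ProbabilityMeasure ℝ, MaxwellKinetic.IsNormalized f₀ →
          MaxwellKinetic.HasFiniteMoment (2 + δ) f₀ →
          -- the unique weak solution
          ∃ g : ℝ → ProbabilityMeasure ℝ,
            MaxwellKinetic.IsWeakSolution p q f₀ g ∧
            (∀ g' : ℝ → ProbabilityMeasure ℝ, MaxwellKinetic.IsWeakSolution p q f₀ g' →
              ∀ t : ℝ, 0 ≤ t → g' t = g t) ∧
            -- uniform bound of the moment of order `2 + δ`
            (∀ t : ℝ, 0 ≤ t → MaxwellKinetic.HasFiniteMoment (2 + δ) (g t) ∧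
              MaxwellKinetic.absMoment (2 + δ) (g t) ≤
                c (MaxwellKinetic.absMoment (2 + δ) f₀)) ∧
            -- exponential contraction towards the stationary solution
            (∀ t : ℝ, 0 ≤ t →
              MaxwellKinetic.fourierDist (2 + δ) (g t) gInf ≤
                MaxwellKinetic.fourierDist (2 + δ) f₀ gInf *
                  ENNReal.ofReal (Real.exp (-|MaxwellKinetic.keyFun p q δ| * t))) ∧
            -- in the metrics of order at most `min (2 + δ) 3` the initial distance is finite
            (∀ η : ℝ, 0 < η → η ≤ δ → η ≤ 1 →
              MaxwellKinetic.keyFun p q η < 0 ∧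
              MaxwellKinetic.fourierDist (2 + η) f₀ gInf < ⊤ ∧
              ∀ t : ℝ, 0 ≤ t →
                MaxwellKinetic.fourierDist (2 + η) (g t) gInf ≤
                  MaxwellKinetic.fourierDist (2 + η) f₀ gInf *
                    ENNReal.ofReal (Real.exp (-|MaxwellKinetic.keyFun p q η| * t))) := by
  have hp : 0 < p := hq.trans hpq
  obtain ⟨μ, hμn, hμs, hμm⟩ := MaxwellKinetic.exists_stationary hp hq hδ hneg
  obtain ⟨k, C, hk, hC, hkδ, hkC⟩ :=
    MaxwellKinetic.exists_integral_collide_rpow_le hp hq hδ hneg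
  refine ⟨μ, hμn, hμs, hμm, fun ν hν hνs => hνs.unique hp hq hδ hneg hν hμn hμs,
    fun m => m + C / k, fun hδ1 m => ?_, fun f₀ hf₀ hfm => ?_⟩
  · obtain ⟨h1, h2⟩ := hkδ hδ1
    rw [h1, h2]
  have hg := MaxwellKinetic.isWeakSolution_rescaledSolution p q f₀
  refine ⟨MaxwellKinetic.rescaledSolution p q f₀, hg, fun g' hg' t ht => hg'.unique hp hq hg ht,
    fun t ht => ⟨MaxwellKinetic.hasFiniteMoment_rescaledSolution hp hq hδ hfm t,
      MaxwellKinetic.absMoment_rescaledSolution_le hp hq hδ hk hC hkC hfm hf₀ ht⟩,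
    fun t ht => hg.fourierDist_le hp hq hμs.isWeakSolution hδ hneg ht, fun η hη hηδ hη1 => ?_⟩
  have hnegη := MaxwellKinetic.keyFun_neg hp hq hδ hneg hη hηδ
  exact ⟨hnegη, hf₀.fourierDist_lt_top hμn hη hη1 (hfm.mono (by linarith) (by linarith))
    (hμm.mono (by linarith) (by linarith)),
    fun t ht => hg.fourierDist_le hp hq hμs.isWeakSolution hη hnegη ht⟩
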